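/- Let $P$ be a right LCM semigroup, i.e. a left cancellative monoid in which any two principal right ideals satisfy $pP\cap qP=\emptyset$ or $pP\cap qP=rP$ for some $r\in P$. When $w\in pP$, write $p^{-1}w$ for the unique $r\in P$ with $pr=w$. Let $\mathcal L=\{\mathcal L(p,q)\}_{p,q\in P}$ be a right-tensor $C^*$-precategory over $P$: the $\mathcal L(p,q)$ are Banach spaces with an associative bilinear composition $\mathcal L(p,q)\times\mathcal L(q,s)\to\mathcal L(p,s)$ with $\|ab\|\le\|a\|\|b\|$, an antilinear contravariant involution with $\|a^*a\|=\|a\|^2$ and $a^*a\in\{b^*b: b\in\mathcal L(q,q)\}$ for $a\in\mathcal L(p,q)$, and linear maps $a\mapsto a\otimes 1_r$, $\mathcal L(p,q)\to\mathcal L(pr,qr)$ $(r\in P)$, preserving composition and involution, with $(a\otimes 1_r)\otimes 1_s=a\otimes 1_{rs}$ and $a\otimes 1_e=a$. Let $\mathcal K$ be a well-aligned ideal in $\mathcal L$: closed subspaces $\mathcal K(p,q)\subseteq\mathcal L(p,q)$ absorbing composition with $\mathcal L$ on both sides, such that $(a\otimes 1_{p^{-1}r})(b\otimes 1_{q^{-1}r})\in\mathcal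 K(r,r)$ for $a\in\mathcal K(p,p)$, $b\in\mathcal K(q,q)$ whenever $pP\cap qP=rP$. Let $\mathcal F_{\mathcal K}=\bigoplus_{s,t\in P}\mathcal K(s,t)$ be the Fock module, i.e. the direct sum Hilbert module over $\bigoplus_t\mathcal K(t,t)$ with $\langle x,y\rangle_t=\sum_s x_{s,t}^*y_{s,t}$. Let $T(a)$, for $a\in\mathcal K(p,q)$, be the adjointable operator on $\mathcal F_{\mathcal K}$ with $T(a)x=(a\otimes 1_{q^{-1}s})x$ for $x\in\mathcal K(s,t)$, $s\in qP$, and $T(a)x=0$ for $x\in\mathcal K(s,t)$, $s\notin qP$ (the Fock representation). The reduced Nica–Toeplitz algebra $\mathcal{NT}^r_{\mathcal L}(\mathcal K)$ is the $C^*$-algebra generated by all $T(a)$. For $a\in\mathcal K(p,q)$ let $T_\Delta(a)$ be the operator that sends $x\in\mathcal K(w,t)$ to $(a\otimes 1_r)x$ if $w=pr=qr$ for some $r\in P$, and to $0$ otherwise. Let $B_{\mathcal K}$ (the transcendental core) be the closed linear span of all $T_\Delta(a)$, $a\in\mathcal K(p,q)$, $p,q\in P$. Let $E^T$ (the transcendental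 conditional expectation) be the restriction to $\mathcal{NT}^r_{\mathcal L}(\mathcal K)$ of $E(R)=\sum_{w\in P}Q_wRQ_w$, where $Q_w$ is the projection of $\mathcal F_{\mathcal K}$ onto $\bigoplus_t\mathcal K(w,t)$. Let $S$, $S_\Delta$, $\mathcal{NT}^r(\mathcal L)$, $B_{\mathcal L}$, $E^S$ be the same objects for $\mathcal K=\mathcal L$. Finally let $\mathcal L_{\mathcal K}(p,q)$ be the closed linear span of all $a\otimes 1_r$ with $a\in\mathcal K(s,t)$, $sr=p$, $tr=q$. Suppose that either $P$ is cancellative, or $\mathcal K$ is essential in $\mathcal L_{\mathcal K}$, i.e. for every $p\in P$, $a\in\mathcal L_{\mathcal K}(p,p)$ and $a\,\mathcal K(p,p)=0$ imply $a=0$. Then there is an injective (hence isometric) $*$-homomorphism $$\iota^r:\mathcal{NT}^r_{\mathcal L}(\mathcal K)\hookrightarrow\mathcal{NT}^r(\mathcal L),\qquad \iota^r(T(a))=S(a)\quad(a\in\mathcal K(p,q),\ p,q\in P).$$ Moreover, $\iota^r$ intertwines the transcendental conditional expectations: there is a linear isometry $\kappa:B_{\mathcal K}\to B_{\mathcal L}$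 with $\kappa(T_\Delta(a))=S_\Delta(a)$ for all $a\in\mathcal K(p,q)$, $p,q\in P$, which agrees with $\iota^r$ on $B_{\mathcal K}\cap\mathcal{NT}^r_{\mathcal L}(\mathcal K)$, such that $E^T$ takes values in $B_{\mathcal K}$ and $$E^S\circ\iota^r=\kappa\circ E^T .$$ If $P$ is cancellative, then $B_{\mathcal K}\subseteq\mathcal{NT}^r_{\mathcal L}(\mathcal K)$, so that $\kappa=\iota^r|_{B_{\mathcal K}}$. -/

import Mathlib

universe u v

namespace NicaToeplitz

open Filter Topology
open scoped ENNReal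

/-! ## C*-precategories -/

/-- A *C*-precategory* with hom-spaces `L σ ρ` (morphisms from `ρ` to `σ`). The Banach space
structures on the hom-spaces are instance arguments. No identity morphisms are required. -/
class CStarPrecategory {Ob : Type u} (L : Ob → Ob → Type v)
    [∀ σ ρ, NormedAddCommGroup (L σ ρ)] [∀ σ ρ, NormedSpace ℂ (L σ ρ)]
    [∀ σ ρ, CompleteSpace (L σ ρ)] where
  /-- Composition of morphisms. -/
  comp {τ σ ρ : Ob} : L τ σ → L σ ρ → L τ ρ
  /-- The involution `a ↦ a*`. -/
  adj {σ ρ : Ob} : L σ ρ → L ρ σ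
  comp_assoc {π τ σ ρ : Ob} (a : L π τ) (b : L τ σ) (c : L σ ρ) :
    comp (comp a b) c = comp a (comp b c)
  comp_add {τ σ ρ : Ob} (a : L τ σ) (b c : L σ ρ) : comp a (b + c) = comp a b + comp a c
  add_comp {τ σ ρ : Ob} (a b : L τ σ) (c : L σ ρ) : comp (a + b) c = comp a c + comp b c
  comp_smul {τ σ ρ : Ob} (z : ℂ) (a : L τ σ) (b : L σ ρ) : comp a (z • b) = z • comp a b
  smul_comp {τ σ ρ : Ob} (z : ℂ) (a : L τ σ) (b : L σ ρ) : comp (z • a) b = z • comp a b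
  norm_comp_le {τ σ ρ : Ob} (a : L τ σ) (b : L σ ρ) : ‖comp a b‖ ≤ ‖a‖ * ‖b‖
  adj_add {σ ρ : Ob} (a b : L σ ρ) : adj (a + b) = adj a + adj b
  adj_smul {σ ρ : Ob} (z : ℂ) (a : L σ ρ) : adj (z • a) = star z • adj a
  adj_adj {σ ρ : Ob} (a : L σ ρ) : adj (adj a) = a
  adj_comp {τ σ ρ : Ob} (a : L τ σ) (b : L σ ρ) : adj (comp a b) = comp (adj b) (adj a)
  norm_adj_comp_self {σ ρ : Ob} (a : L σ ρ) : ‖comp (adj a) a‖ = ‖a‖ ^ 2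
  exists_adj_comp_self {σ ρ : Ob} (a : L σ ρ) : ∃ b : L ρ ρ, comp (adj a) a = comp (adj b) b

namespace CStarPrecategory

attribute [simp] adj_adj

variable {Ob : Type u} {L : Ob → Ob → Type v}
    [∀ σ ρ, NormedAddCommGroup (L σ ρ)] [∀ σ ρ, NormedSpace ℂ (L σ ρ)]
    [∀ σ ρ, CompleteSpace (L σ ρ)] [CStarPrecategory L]

@[simp] lemma comp_zero {τ σ ρ : Ob} (a : L τ σ) : comp a (0 : L σ ρ) = 0 := by
  simpa using comp_smul (0 : ℂ) a (0 : L σ ρ)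

@[simp] lemma zero_comp {τ σ ρ : Ob} (b : L σ ρ) : comp (0 : L τ σ) b = 0 := by
  simpa using smul_comp (0 : ℂ) (0 : L τ σ) b

@[simp] lemma adj_zero {σ ρ : Ob} : adj (0 : L σ ρ) = 0 := by
  simpa using adj_smul (0 : ℂ) (0 : L σ ρ)

end CStarPrecategory

open CStarPrecategory

section Diag

variable {Ob : Type u} (L : Ob → Ob → Type v)
    [∀ σ ρ, NormedAddCommGroup (L σ ρ)] [∀ σ ρ, NormedSpace ℂ (L σ ρ)]
    [∀ σ ρ, CompleteSpace (L σ ρ)] [CStarPrecategory L]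

/-- The diagonal hom-space `L t t`, regarded as a C*-algebra. -/
def Diag {Ob : Type u} (L : Ob → Ob → Type v) (t : Ob) : Type v := L t t

noncomputable instance (t : Ob) : NormedAddCommGroup (Diag L t) :=
  inferInstanceAs (NormedAddCommGroup (L t t))

noncomputable instance (t : Ob) : NormedSpace ℂ (Diag L t) :=
  inferInstanceAs (NormedSpace ℂ (L t t))

instance (t : Ob) : CompleteSpace (Diag L t) := inferInstanceAs (CompleteSpace (L t t))

noncomputable instance (t : Ob) : NonUnitalCStarAlgebra (Diag L t) where
  dist_eq := fun a b => dist_eq_norm_neg_add a b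
  mul := fun a b => (comp (L := L) a b : L t t)
  left_distrib := fun a b c => comp_add (L := L) a b c
  right_distrib := fun a b c => add_comp (L := L) a b c
  zero_mul := fun a => zero_comp (L := L) a
  mul_zero := fun a => comp_zero (L := L) a
  mul_assoc := fun a b c => comp_assoc (L := L) a b c
  norm_mul_le := fun a b => norm_comp_le (L := L) a b
  star := fun a => (adj (L := L) a : L t t)
  star_involutive := fun a => adj_adj (L := L) a
  star_mul := fun a b => adj_comp (L := L) a b
  star_add := fun a b => adj_add (L := L) a b
  norm_mul_self_le := fun a => by
    have h := norm_adj_comp_self (L := L) (σ := t) (ρ := t) a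
    rw [sq] at h
    exact h.ge
  __ := (inferInstance : NormedSpace ℂ (Diag L t))
  smul_assoc := fun z a b => smul_comp (L := L) z a b
  smul_comm := fun z a b => (comp_smul (L := L) z a b).symm
  star_smul := fun z a => adj_smul (L := L) z a

/-- The usual order on a C*-algebra: `a ≤ b` iff `b - a` is positive. -/
noncomputable instance (t : Ob) : PartialOrder (Diag L t) := CStarAlgebra.spectralOrder _

instance (t : Ob) : StarOrderedRing (Diag L t) := CStarAlgebra.spectralOrderedRing _

variable {L}

/-- The `Diag L t`-valued inner product `⟨x, y⟩ = x* y` on `L s t`. -/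
def ip {s t : Ob} (x y : L s t) : Diag L t := comp (adj x) y

lemma ip_add_right {s t : Ob} (x y z : L s t) : ip x (y + z) = ip x y + ip x z :=
  comp_add (L := L) _ _ _

lemma ip_add_left {s t : Ob} (x y z : L s t) : ip (x + y) z = ip x z + ip y z := by
  unfold ip; rw [adj_add]; exact add_comp (L := L) _ _ _

lemma ip_smul_right {s t : Ob} (c : ℂ) (x y : L s t) : ip x (c • y) = c • ip x y :=
  comp_smul (L := L) _ _ _

lemma ip_smul_left {s t : Ob} (c : ℂ) (x y : L s t) : ip (c • x) y = star c • ip x y := by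
  unfold ip; rw [adj_smul]; exact smul_comp (L := L) _ _ _

lemma star_ip {s t : Ob} (x y : L s t) : star (ip x y) = ip y x := by
  refine (adj_comp (L := L) (adj x) y).trans ?_
  rw [adj_adj]; rfl

@[simp] lemma ip_zero_right {s t : Ob} (x : L s t) : ip x (0 : L s t) = 0 := comp_zero (L := L) _

@[simp] lemma ip_zero_left {s t : Ob} (x : L s t) : ip (0 : L s t) x = 0 := by
  unfold ip; rw [adj_zero]; exact zero_comp (L := L) _

lemma ip_self_nonneg {s t : Ob} (x : L s t) : 0 ≤ ip x x := by
  obtain ⟨b, hb⟩ := exists_adj_comp_self (L := L) x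
  have : ip x x = star (show Diag L t from b) * (show Diag L t from b) := hb
  rw [this]; exact star_mul_self_nonneg _

lemma norm_ip_self {s t : Ob} (x : L s t) : ‖ip x x‖ = ‖x‖ ^ 2 := norm_adj_comp_self (L := L) x

lemma ip_comp_left {s t w : Ob} (b : L w s) (x : L s t) (y : L w t) :
    ip (comp b x) y = ip x (comp (adj b) y) := by
  unfold ip; rw [adj_comp, comp_assoc]

lemma norm_adj {s t : Ob} (x : L s t) : ‖adj x‖ = ‖x‖ := by
  have key : ∀ {s t : Ob} (x : L s t), ‖x‖ ≤ ‖adj x‖ := by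
    intro s t x
    have h1 := norm_adj_comp_self (L := L) x
    have h2 := norm_comp_le (L := L) (adj x) x
    rcases (norm_nonneg x).eq_or_lt with h | h
    · rw [← h]; exact norm_nonneg _
    · nlinarith
  exact le_antisymm (by simpa using key (adj x)) (key x)

lemma exists_sqrt_sub {A : Type*} [NonUnitalCStarAlgebra A] [PartialOrder A] [StarOrderedRing A]
    {c : A} (hc : 0 ≤ c) {β : ℝ} (hβ : 0 ≤ β) (hcb : ‖c‖ ≤ β ^ 2) :
    ∃ d : A, star d = d ∧ (2 * β) • d + d * d = -c := by
  have hsa : IsSelfAdjoint c := .of_nonneg hc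
  let f : ℝ → ℝ := fun y => √(β ^ 2 - y) - β
  have hf : Continuous f := by fun_prop
  have hf0 : f 0 = 0 := by simp [f, Real.sqrt_sq hβ]
  refine ⟨cfcₙ f c, cfcₙ_predicate f c, ?_⟩
  rw [← cfcₙ_smul _ f c hf.continuousOn hf0, ← cfcₙ_mul f f c hf.continuousOn hf0 hf.continuousOn hf0,
    ← cfcₙ_add (a := c) (fun x => (2 * β) • f x) (fun x => f x * f x)
      (by fun_prop) (by simp [hf0]) (by fun_prop) (by simp [hf0])]
  conv_rhs => rw [← cfcₙ_id' ℝ c, ← cfcₙ_neg]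
  refine cfcₙ_congr fun y hy => ?_
  have hy1 : y ≤ β ^ 2 :=
    (le_abs_self y).trans ((NonUnitalIsometricContinuousFunctionalCalculus.norm_quasispectrum_le
      c hy).trans hcb)
  have := Real.sq_sqrt (sub_nonneg.2 hy1)
  simp only [f, smul_eq_mul]
  nlinarith

/-- Left multiplication of `L s t` by the C*-algebra `Diag L s`. -/
def lact {s t : Ob} (d : Diag L s) (x : L s t) : L s t := comp (L := L) d x

/-- Right multiplication of `L s t` by the C*-algebra `Diag L t`. -/
def ract {s t : Ob} (x : L s t) (d : Diag L t) : L s t := comp (L := L) x d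

lemma add_lact {s t : Ob} (c d : Diag L s) (x : L s t) :
    lact (c + d) x = lact c x + lact d x := add_comp (L := L) _ _ _

lemma mul_lact {s t : Ob} (c d : Diag L s) (x : L s t) :
    lact (c * d) x = lact c (lact d x) := comp_assoc (L := L) _ _ _

lemma smul_lact {s t : Ob} (z : ℂ) (d : Diag L s) (x : L s t) :
    lact (z • d) x = z • lact d x := smul_comp (L := L) _ _ _

lemma ip_lact {s t : Ob} (d : Diag L s) (x y : L s t) :
    ip (lact d x) y = ip x (lact (star d) y) := ip_comp_left (L := L) _ _ _

lemma ip_ract {s t : Ob} (x y : L s t) (d : Diag L t) :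
    ip x (ract y d) = ip x y * d := (comp_assoc (L := L) _ _ _).symm

lemma ip_comp_self {s t w : Ob} (b : L w s) (x : L s t) :
    ip (comp b x) (comp b x) = ip x (lact (ip b b) x) := by
  rw [ip_comp_left, ← comp_assoc]; rfl

lemma ip_comp_self_le {s t w : Ob} (b : L w s) (x : L s t) {β : ℝ} (hβ : ‖b‖ ≤ β) :
    ip (comp b x) (comp b x) ≤ (β ^ 2) • ip x x := by
  have hβ0 : 0 ≤ β := (norm_nonneg b).trans hβ
  obtain ⟨d, hd, hd2⟩ := exists_sqrt_sub (ip_self_nonneg b) hβ0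
    (by rw [norm_ip_self]; gcongr)
  have h0 := ip_self_nonneg ((β : ℂ) • x + lact d x)
  have e2 : ip b b = ((-1 : ℂ)) • (((2 * β : ℝ) : ℂ) • d + d * d) := by
    rw [neg_one_smul, ← neg_eq_iff_eq_neg, ← hd2]; rfl
  have e5 : (β ^ 2) • ip x x = ((β ^ 2 : ℝ) : ℂ) • ip x x := rfl
  have e3 : ip ((β : ℂ) • x + lact d x) ((β : ℂ) • x + lact d x)
      = (β ^ 2) • ip x x - ip (comp b x) (comp b x) := by
    rw [ip_comp_self, e2, smul_lact, add_lact, mul_lact, smul_lact, e5]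
    simp only [ip_add_left, ip_add_right, ip_smul_left, ip_smul_right, ip_lact, hd]
    simp only [RCLike.star_def, Complex.conj_ofReal]
    push_cast
    module
  rw [e3] at h0
  exact sub_nonneg.1 h0

end Diag

section Continuity

variable {Ob : Type u} {L : Ob → Ob → Type v}
    [∀ σ ρ, NormedAddCommGroup (L σ ρ)] [∀ σ ρ, NormedSpace ℂ (L σ ρ)]
    [∀ σ ρ, CompleteSpace (L σ ρ)] [CStarPrecategory L]

lemma ip_neg_right {s t : Ob} (x y : L s t) : ip x (-y) = -ip x y := by
  simpa using ip_smul_right (-1 : ℂ) x y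

lemma ip_neg_left {s t : Ob} (x y : L s t) : ip (-x) y = -ip x y := by
  simpa using ip_smul_left (-1 : ℂ) x y

lemma ip_sub_right {s t : Ob} (x y z : L s t) : ip x (y - z) = ip x y - ip x z := by
  rw [sub_eq_add_neg, ip_add_right, ip_neg_right, ← sub_eq_add_neg]

lemma ip_sub_left {s t : Ob} (x y z : L s t) : ip (x - y) z = ip x z - ip y z := by
  rw [sub_eq_add_neg, ip_add_left, ip_neg_left, ← sub_eq_add_neg]

lemma norm_ip_le {s t : Ob} (x y : L s t) : ‖ip x y‖ ≤ ‖x‖ * ‖y‖ := by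
  have h := norm_comp_le (L := L) (adj x) y
  rw [norm_adj] at h
  exact h

lemma continuous_ip_self {s t : Ob} : Continuous fun x : L s t => ip x x := by
  rw [continuous_iff_continuousAt]
  intro x
  rw [ContinuousAt, tendsto_iff_norm_sub_tendsto_zero]
  have h1 : Tendsto (fun y : L s t => ‖y - x‖ * ‖y‖ + ‖x‖ * ‖y - x‖) (𝓝 x) (𝓝 0) := by
    have : Continuous (fun y : L s t => ‖y - x‖ * ‖y‖ + ‖x‖ * ‖y - x‖) := by fun_prop
    simpa using this.tendsto x
  refine squeeze_zero (fun _ => norm_nonneg _) (fun y => ?_) h1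
  have : ip y y - ip x x = ip (y - x) y + ip x (y - x) := by
    rw [ip_sub_left, ip_sub_right]; abel
  rw [this]
  exact (norm_add_le _ _).trans (add_le_add (norm_ip_le _ _) (norm_ip_le _ _))

lemma ip_add_self_le {s t : Ob} (x y : L s t) :
    ip (x + y) (x + y) ≤ (2 : ℝ) • ip x x + (2 : ℝ) • ip y y := by
  have h := ip_self_nonneg (x - y)
  rw [← sub_nonneg]
  convert h using 1
  simp only [ip_add_left, ip_add_right, ip_sub_left, ip_sub_right, two_smul]
  abel

lemma summable_of_nonneg_of_le {ι A : Type*} [NonUnitalCStarAlgebra A] [PartialOrder A]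
    [StarOrderedRing A] {f g : ι → A} (hf : ∀ i, 0 ≤ f i) (hfg : ∀ i, f i ≤ g i)
    (hg : Summable g) : Summable f := by
  rw [summable_iff_vanishing_norm] at hg ⊢
  intro ε hε
  obtain ⟨s, hs⟩ := hg ε hε
  refine ⟨s, fun t ht => lt_of_le_of_lt ?_ (hs t ht)⟩
  exact CStarAlgebra.norm_le_norm_of_nonneg_of_le (Finset.sum_nonneg fun i _ => hf i)
    (Finset.sum_le_sum fun i _ => hfg i)

end Continuity

/-! ## Ideals -/

/-- An ideal `K` in a C*-precategory: closed subspaces `K σ ρ ⊆ L σ ρ` that absorb composition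
with arbitrary morphisms from both sides. -/
structure HomIdeal {Ob : Type u} (L : Ob → Ob → Type v)
    [∀ σ ρ, NormedAddCommGroup (L σ ρ)] [∀ σ ρ, NormedSpace ℂ (L σ ρ)]
    [∀ σ ρ, CompleteSpace (L σ ρ)] [CStarPrecategory L] where
  hom (σ ρ : Ob) : Submodule ℂ (L σ ρ)
  isClosed_hom (σ ρ : Ob) : IsClosed (hom σ ρ : Set (L σ ρ))
  comp_mem_left {τ σ ρ : Ob} (a : L τ σ) {k : L σ ρ} : k ∈ hom σ ρ → comp a k ∈ hom τ ρ
  comp_mem_right {τ σ ρ : Ob} {k : L τ σ} (a : L σ ρ) : k ∈ hom τ σ → comp k a ∈ hom τ ρ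

/-- `L` as an ideal in itself. -/
instance {Ob : Type u} (L : Ob → Ob → Type v)
    [∀ σ ρ, NormedAddCommGroup (L σ ρ)] [∀ σ ρ, NormedSpace ℂ (L σ ρ)]
    [∀ σ ρ, CompleteSpace (L σ ρ)] [CStarPrecategory L] : Top (HomIdeal L) where
  top :=
    { hom := fun _ _ => ⊤
      isClosed_hom := fun _ _ => isClosed_univ
      comp_mem_left := fun _ _ _ => trivial
      comp_mem_right := fun _ _ => trivial }

/-! ## The Hilbert modules `⨁ₛ K s t` -/

section Column

variable {Ob : Type u} {L : Ob → Ob → Type v}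
    [∀ σ ρ, NormedAddCommGroup (L σ ρ)] [∀ σ ρ, NormedSpace ℂ (L σ ρ)]
    [∀ σ ρ, CompleteSpace (L σ ρ)] [CStarPrecategory L]

lemma summable_ip {ι : Type*} {c : ι → Ob} {t : Ob} {x y : ∀ i, L (c i) t}
    (hx : Summable fun i => ip (x i) (x i)) (hy : Summable fun i => ip (y i) (y i)) :
    Summable fun i => ip (x i) (y i) := by
  have key : ∀ z : ℂ, Summable fun i => ip (x i + z • y i) (x i + z • y i) := fun z => by
    refine summable_of_nonneg_of_le (fun i => ip_self_nonneg _) (fun i => ip_add_self_le _ _)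
      ((hx.const_smul (2 : ℝ)).add (Summable.const_smul (2 : ℝ) ?_))
    simp only [ip_smul_left, ip_smul_right]
    exact (hy.const_smul (star z)).const_smul z
  have h1 := ((key 1).sub hx).sub hy
  have h2 := (((key Complex.I).sub hx).sub hy).const_smul (-Complex.I)
  refine ((h1.add h2).const_smul (1 / 2 : ℂ)).congr fun i => ?_
  simp only [ip_add_left, ip_add_right, ip_smul_left, ip_smul_right, RCLike.star_def,
    Complex.conj_I, one_smul]
  match_scalars
  all_goals ring_nf
  all_goals simp [Complex.I_sq]
  all_goals norm_num

/-- The space of families `(xₛ)` with `xₛ ∈ K s t` for which `∑ₛ xₛ* xₛ` converges in norm. -/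
def columnSubmodule (K : HomIdeal L) (t : Ob) : Submodule ℂ (∀ s, L s t) where
  carrier := {x | (∀ s, x s ∈ K.hom s t) ∧ Summable fun s => ip (x s) (x s)}
  add_mem' {x y} hx hy := ⟨fun s => add_mem (hx.1 s) (hy.1 s),
    summable_of_nonneg_of_le (fun _ => ip_self_nonneg _) (fun _ => ip_add_self_le _ _)
      ((hx.2.const_smul (2 : ℝ)).add (hy.2.const_smul (2 : ℝ)))⟩
  zero_mem' := ⟨fun s => zero_mem _, by simp [summable_zero]⟩
  smul_mem' c x hx := ⟨fun s => Submodule.smul_mem _ _ (hx.1 s), by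
    simp only [Pi.smul_apply, ip_smul_left, ip_smul_right]
    exact (hx.2.const_smul (star c)).const_smul c⟩

/-- The Hilbert module `⨁ₛ K s t` (with `t` fixed) over the C*-algebra `K t t ⊆ L t t`. -/
def FockColumn (K : HomIdeal L) (t : Ob) : Type (max u v) := columnSubmodule K t

namespace FockColumn

variable {K : HomIdeal L} {t : Ob}

instance : AddCommGroup (FockColumn K t) := inferInstanceAs (AddCommGroup (columnSubmodule K t))

instance : Module ℂ (FockColumn K t) := inferInstanceAs (Module ℂ (columnSubmodule K t))

instance : CoeFun (FockColumn K t) (fun _ => ∀ s, L s t) := ⟨fun x => x.1⟩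

@[ext] lemma ext {x y : FockColumn K t} (h : ∀ s, x s = y s) : x = y := Subtype.ext (funext h)

@[simp] lemma add_apply (x y : FockColumn K t) (s : Ob) : (x + y) s = x s + y s := rfl
@[simp] lemma sub_apply (x y : FockColumn K t) (s : Ob) : (x - y) s = x s - y s := rfl
@[simp] lemma smul_apply (c : ℂ) (x : FockColumn K t) (s : Ob) : (c • x) s = c • x s := rfl
@[simp] lemma zero_apply (s : Ob) : (0 : FockColumn K t) s = 0 := rfl

lemma mem (x : FockColumn K t) (s : Ob) : x s ∈ K.hom s t := x.2.1 s

lemma summable (x y : FockColumn K t) : Summable fun s => ip (x s) (y s) :=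
  summable_ip x.2.2 y.2.2

/-- The inner product `⟨x, y⟩ = ∑ₛ xₛ* yₛ`. -/
noncomputable def inner (x y : FockColumn K t) : Diag L t := ∑' s, ip (x s) (y s)

/-- The inner product takes values in `K t t`. -/
lemma inner_mem (x y : FockColumn K t) : (inner x y : L t t) ∈ K.hom t t := by
  let M : Submodule ℂ (Diag L t) := K.hom t t
  have h : IsClosed (M : Set (Diag L t)) := K.isClosed_hom t t
  exact h.mem_of_tendsto (x.summable y).hasSum (Eventually.of_forall fun F =>
    M.sum_mem fun s _ => K.comp_mem_left _ (y.mem s))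

lemma inner_add_right (x y z : FockColumn K t) : inner x (y + z) = inner x y + inner x z := by
  simp only [inner, add_apply, ip_add_right]
  exact (x.summable y).tsum_add (x.summable z)

lemma star_inner (x y : FockColumn K t) : star (inner x y) = inner y x := by
  simp only [inner, tsum_star, star_ip]

lemma inner_add_left (x y z : FockColumn K t) : inner (x + y) z = inner x z + inner y z := by
  rw [← star_inner, inner_add_right, star_add, star_inner, star_inner]

lemma inner_smul_right (c : ℂ) (x y : FockColumn K t) : inner x (c • y) = c • inner x y := by
  simp only [inner, smul_apply, ip_smul_right]
  exact (x.summable y).tsum_const_smul c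

lemma inner_smul_left (c : ℂ) (x y : FockColumn K t) : inner (c • x) y = star c • inner x y := by
  rw [← star_inner, inner_smul_right, star_smul, star_inner]

lemma inner_self_nonneg (x : FockColumn K t) : 0 ≤ inner x x :=
  tsum_nonneg fun _ => ip_self_nonneg _

lemma sum_le_inner_self (x : FockColumn K t) (F : Finset Ob) :
    ∑ s ∈ F, ip (x s) (x s) ≤ inner x x :=
  (x.summable x).sum_le_tsum F fun _ _ => ip_self_nonneg _

lemma ip_le_inner_self (x : FockColumn K t) (s : Ob) : ip (x s) (x s) ≤ inner x x := by
  simpa using x.sum_le_inner_self {s}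

lemma inner_self_eq_zero {x : FockColumn K t} : inner x x = 0 ↔ x = 0 := by
  constructor
  · intro h
    ext s
    have h1 := x.ip_le_inner_self s
    rw [h] at h1
    have h2 : ip (x s) (x s) = 0 := le_antisymm h1 (ip_self_nonneg _)
    have h3 := norm_ip_self (x s)
    rw [h2, norm_zero] at h3
    simpa using h3.symm
  · rintro rfl
    simp [inner]

/-- The right action of `Diag L t`. -/
def rsmul (x : FockColumn K t) (d : Diag L t) : FockColumn K t :=
  ⟨fun s => ract (x s) d, fun s => K.comp_mem_right _ (x.mem s), by
    have h : ∀ s, ip (ract (x s) d) (ract (x s) d) = star d * (ip (x s) (x s) * d) := fun s => by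
      rw [ip_ract, ← star_ip, ip_ract, star_mul, star_ip, mul_assoc]
    simp only [h]
    exact ((x.summable x).mul_right d).mul_left (star d)⟩

lemma inner_rsmul_right (x y : FockColumn K t) (d : Diag L t) :
    inner x (rsmul y d) = inner x y * d := by
  have h : ∀ s, ip (x s) (rsmul y d s) = ip (x s) (y s) * d := fun s => ip_ract _ _ _
  simp only [inner, h]
  exact (x.summable y).tsum_mul_right d

lemma inner_rsmul_left (x y : FockColumn K t) (d : Diag L t) :
    inner (rsmul x d) y = star d * inner x y := by
  rw [← star_inner, inner_rsmul_right, star_mul, star_inner]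

/-- The Hilbert module norm `‖x‖ = ‖⟨x, x⟩‖^(1/2)`. -/
noncomputable instance : Norm (FockColumn K t) := ⟨fun x => √‖inner x x‖⟩

lemma norm_sq (x : FockColumn K t) : ‖x‖ ^ 2 = ‖inner x x‖ := Real.sq_sqrt (norm_nonneg _)

lemma norm_nonneg' (x : FockColumn K t) : 0 ≤ ‖x‖ := Real.sqrt_nonneg _

lemma norm_inner_le (x y : FockColumn K t) : ‖inner x y‖ ≤ ‖x‖ * ‖y‖ := by
  rcases (norm_nonneg' x).eq_or_lt with h | h
  · have h1 : inner x x = 0 := by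
      have := norm_sq x
      rw [← h] at this
      simpa using this.symm
    rw [inner_self_eq_zero.1 h1]
    have : inner (0 : FockColumn K t) y = 0 := by simp [inner]
    rw [this, norm_zero]
    exact mul_nonneg (norm_nonneg' _) (norm_nonneg' _)
  · set a : Diag L t := inner x y
    set n : ℝ := ‖x‖ with hn
    have hx : ‖inner x x‖ = n ^ 2 := (norm_sq x).symm
    have h0 := inner_self_nonneg ((((n ^ 2 : ℝ) : ℂ)) • y + (-1 : ℂ) • rsmul x a)
    have hc : star a * inner x x * a ≤ (n ^ 2) • (star a * a) := by
      rw [← hx]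
      exact CStarAlgebra.star_left_conjugate_le_norm_smul (.of_nonneg (inner_self_nonneg x))
    have e : inner ((((n ^ 2 : ℝ) : ℂ)) • y + (-1 : ℂ) • rsmul x a)
        ((((n ^ 2 : ℝ) : ℂ)) • y + (-1 : ℂ) • rsmul x a)
        = (n ^ 2 * n ^ 2) • inner y y - (2 * n ^ 2) • (star a * a) + star a * inner x x * a := by
      have e1 : (n ^ 2 * n ^ 2) • inner y y = (((n ^ 2 * n ^ 2 : ℝ)) : ℂ) • inner y y := rfl
      have e2 : (2 * n ^ 2) • (star a * a) = (((2 * n ^ 2 : ℝ)) : ℂ) • (star a * a) := rfl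
      have e3 : inner y x = star a := (star_inner x y).symm
      rw [e1, e2]
      simp only [inner_add_left, inner_add_right, inner_smul_left, inner_smul_right,
        inner_rsmul_left, inner_rsmul_right, RCLike.star_def, Complex.conj_ofReal, e3,
        map_neg, map_one, mul_assoc, add_mul, smul_mul_assoc]
      rw [show inner x y = a from rfl]
      push_cast
      module
    rw [e] at h0
    have h2 : (n ^ 2) • (star a * a) ≤ (n ^ 2 * n ^ 2) • inner y y := by
      have h3 := add_le_add h0 hc
      have h4 : (2 * n ^ 2) • (star a * a) = (n ^ 2) • (star a * a) + (n ^ 2) • (star a * a) := by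
        rw [← add_smul]; ring_nf
      rw [h4, zero_add] at h3
      rw [← sub_nonneg] at h3 ⊢
      convert h3 using 1
      abel
    have h5 := CStarAlgebra.norm_le_norm_of_nonneg_of_le
      (smul_nonneg (sq_nonneg n) (star_mul_self_nonneg a)) h2
    rw [norm_smul, norm_smul, CStarRing.norm_star_mul_self, ← norm_sq y, Real.norm_of_nonneg
      (by positivity), Real.norm_of_nonneg (by positivity)] at h5
    have h6 : ‖a‖ ^ 2 ≤ (n * ‖y‖) ^ 2 := by
      have hp : 0 < n ^ 2 := by positivity
      refine le_of_mul_le_mul_left ?_ hp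
      nlinarith
    exact (sq_le_sq₀ (norm_nonneg _) (mul_nonneg h.le (norm_nonneg' y))).1 h6

lemma core : NormedSpace.Core ℂ (FockColumn K t) where
  norm_nonneg := norm_nonneg'
  norm_smul c x := by
    have h : ‖c • x‖ ^ 2 = (‖c‖ * ‖x‖) ^ 2 := by
      rw [mul_pow, norm_sq, norm_sq, inner_smul_left, inner_smul_right, norm_smul, norm_smul,
        norm_star]
      ring
    exact (sq_eq_sq₀ (norm_nonneg' _) (mul_nonneg (norm_nonneg _) (norm_nonneg' _))).1 h
  norm_triangle x y := by
    refine (sq_le_sq₀ (norm_nonneg' _) (add_nonneg (norm_nonneg' _) (norm_nonneg' _))).1 ?_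
    have h : inner (x + y) (x + y) = inner x x + inner x y + inner y x + inner y y := by
      rw [inner_add_left, inner_add_right, inner_add_right]; abel
    rw [norm_sq, h]
    have h1 := norm_add₃_le (a := inner x x + inner x y) (b := inner y x) (c := inner y y)
    have h2 := norm_add_le (inner x x) (inner x y)
    have h3 := norm_inner_le x y
    have h4 := norm_inner_le y x
    have h5 := norm_sq x
    have h6 := norm_sq y
    nlinarith
  norm_eq_zero_iff x := by
    rw [← inner_self_eq_zero]
    exact (Real.sqrt_eq_zero (norm_nonneg _)).trans norm_eq_zero

noncomputable instance : NormedAddCommGroup (FockColumn K t) := NormedAddCommGroup.ofCore core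

noncomputable instance : NormedSpace ℂ (FockColumn K t) := NormedSpace.ofCore core

lemma norm_sum_le (x : FockColumn K t) (F : Finset Ob) :
    ‖∑ s ∈ F, ip (x s) (x s)‖ ≤ ‖x‖ ^ 2 := by
  rw [norm_sq]
  exact CStarAlgebra.norm_le_norm_of_nonneg_of_le (Finset.sum_nonneg fun _ _ => ip_self_nonneg _)
    (x.sum_le_inner_self F)

lemma norm_apply_le (x : FockColumn K t) (s : Ob) : ‖x s‖ ≤ ‖x‖ := by
  have h := x.norm_sum_le {s}
  rw [Finset.sum_singleton, norm_ip_self] at h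
  exact (sq_le_sq₀ (norm_nonneg _) (norm_nonneg _)).1 h

instance : CompleteSpace (FockColumn K t) := by
  refine Metric.complete_of_cauchySeq_tendsto fun w hw => ?_
  have hcoord : ∀ s, CauchySeq fun n => w n s := fun s => by
    rw [Metric.cauchySeq_iff'] at hw ⊢
    intro ε hε
    obtain ⟨N, hN⟩ := hw ε hε
    refine ⟨N, fun n hn => ?_⟩
    rw [dist_eq_norm]
    exact lt_of_le_of_lt ((w n - w N).norm_apply_le s) (by simpa [dist_eq_norm] using hN n hn)
  choose y hy using fun s => cauchySeq_tendsto_of_complete (hcoord s)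
  have hfin : ∀ ε > 0, ∃ N, ∀ n ≥ N, ∀ F : Finset Ob,
      ‖∑ s ∈ F, ip (y s - w n s) (y s - w n s)‖ ≤ ε ^ 2 := by
    intro ε hε
    obtain ⟨N, hN⟩ := Metric.cauchySeq_iff.1 hw ε hε
    refine ⟨N, fun n hn F => ?_⟩
    have h1 : Tendsto (fun m => ‖∑ s ∈ F, ip (w m s - w n s) (w m s - w n s)‖) atTop
        (𝓝 ‖∑ s ∈ F, ip (y s - w n s) (y s - w n s)‖) :=
      (tendsto_finsetSum F fun s _ =>
        (continuous_ip_self.tendsto _).comp ((hy s).sub_const (w n s))).norm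
    refine le_of_tendsto h1 (eventually_atTop.2 ⟨N, fun m hm => ?_⟩)
    refine ((w m - w n).norm_sum_le F).trans ?_
    have := (hN m hm n hn).le
    rw [dist_eq_norm] at this
    gcongr
  have hmem : ∀ s, y s ∈ K.hom s t := fun s =>
    (K.isClosed_hom s t).mem_of_tendsto (hy s) (Eventually.of_forall fun n => (w n).mem s)
  have hsum : Summable fun s => ip (y s) (y s) := by
    rw [summable_iff_vanishing_norm]
    intro ε hε
    obtain ⟨N, hN⟩ := hfin (√(ε / 4)) (by positivity)
    obtain ⟨G, hG⟩ := (summable_iff_vanishing_norm.1 ((w N).summable (w N))) (ε / 4) (by positivity)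
    refine ⟨G, fun F hF => ?_⟩
    have h1 := hN N le_rfl F
    rw [Real.sq_sqrt (by positivity)] at h1
    have h2 := hG F hF
    have h3 : ∑ s ∈ F, ip (y s) (y s) ≤ (2 : ℝ) • ∑ s ∈ F, ip (y s - w N s) (y s - w N s)
        + (2 : ℝ) • ∑ s ∈ F, ip (w N s) (w N s) := by
      rw [Finset.smul_sum, Finset.smul_sum, ← Finset.sum_add_distrib]
      refine Finset.sum_le_sum fun s _ => ?_
      simpa using ip_add_self_le (y s - w N s) (w N s)
    have h4 := CStarAlgebra.norm_le_norm_of_nonneg_of_le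
      (Finset.sum_nonneg fun s _ => ip_self_nonneg (y s)) h3
    have h5 := h4.trans (norm_add_le _ _)
    rw [norm_smul, norm_smul, Real.norm_of_nonneg zero_le_two] at h5
    linarith
  let z : FockColumn K t := ⟨y, hmem, hsum⟩
  refine ⟨z, ?_⟩
  rw [Metric.tendsto_atTop]
  intro ε hε
  obtain ⟨N, hN⟩ := hfin (ε / 2) (by positivity)
  refine ⟨N, fun n hn => ?_⟩
  rw [dist_comm, dist_eq_norm]
  have h1 : ‖z - w n‖ ^ 2 ≤ (ε / 2) ^ 2 := by
    rw [norm_sq]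
    exact le_of_tendsto ((z - w n).summable (z - w n)).hasSum.norm
      (Eventually.of_forall fun F => hN n hn F)
  have h2 := (sq_le_sq₀ (norm_nonneg _) (by positivity)).1 h1
  linarith

end FockColumn

end Column

/-! ## The Fock module and its adjointable operators -/

section Fock

variable {Ob : Type u} {L : Ob → Ob → Type v}
    [∀ σ ρ, NormedAddCommGroup (L σ ρ)] [∀ σ ρ, NormedSpace ℂ (L σ ρ)]
    [∀ σ ρ, CompleteSpace (L σ ρ)] [CStarPrecategory L]

/-- The families `(xₜ)` with `xₜ ∈ ⨁ₛ K s t` and `‖xₜ‖ → 0`, with the supremum norm. -/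
def fockSubmodule (K : HomIdeal L) : Submodule ℂ (lp (FockColumn K) ∞) where
  carrier := {x | Tendsto (fun t => ‖x t‖) cofinite (𝓝 0)}
  add_mem' {x y} hx hy := by
    refine squeeze_zero (fun _ => norm_nonneg _) (fun t => norm_add_le (x t) (y t)) ?_
    simpa using Tendsto.add hx hy
  zero_mem' := by simp [tendsto_const_nhds]
  smul_mem' c x hx := by
    have : Tendsto (fun t => ‖c‖ * ‖x t‖) cofinite (𝓝 0) := by
      simpa using Tendsto.const_mul ‖c‖ hx
    exact this.congr fun t => (norm_smul c (x t)).symm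

/-- The *Fock module* `⨁ₜ ⨁ₛ K s t` of `K`: the direct sum Hilbert module over the direct sum
`⨁ₜ K t t` of C*-algebras. Its inner product is `⟨x, y⟩ₜ = FockColumn.inner (x.col t) (y.col t)`,
and the component of `x : Fock K` in `K s t` is `x.col t s`. -/
def Fock (K : HomIdeal L) : Type (max u v) := fockSubmodule K

namespace Fock

variable {K : HomIdeal L}

noncomputable instance : NormedAddCommGroup (Fock K) :=
  inferInstanceAs (NormedAddCommGroup (fockSubmodule K))

noncomputable instance : NormedSpace ℂ (Fock K) :=
  inferInstanceAs (NormedSpace ℂ (fockSubmodule K))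

/-- The component of `x` in `⨁ₛ K s t`. -/
def col (x : Fock K) (t : Ob) : FockColumn K t := x.1 t

@[simp] lemma col_add (x y : Fock K) (t : Ob) : (x + y).col t = x.col t + y.col t := rfl
@[simp] lemma col_sub (x y : Fock K) (t : Ob) : (x - y).col t = x.col t - y.col t := rfl
@[simp] lemma col_smul (c : ℂ) (x : Fock K) (t : Ob) : (c • x).col t = c • x.col t := rfl
@[simp] lemma col_zero (t : Ob) : (0 : Fock K).col t = 0 := rfl

lemma ext {x y : Fock K} (h : ∀ t s, x.col t s = y.col t s) : x = y :=
  Subtype.ext (lp.ext (funext fun t => FockColumn.ext (h t)))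

lemma norm_col_le (x : Fock K) (t : Ob) : ‖x.col t‖ ≤ ‖x‖ :=
  lp.norm_apply_le_norm ENNReal.top_ne_zero x.1 t

lemma norm_le {x : Fock K} {C : ℝ} (hC : 0 ≤ C) (h : ∀ t, ‖x.col t‖ ≤ C) : ‖x‖ ≤ C :=
  lp.norm_le_of_forall_le hC h

lemma isClosed_fockSubmodule : IsClosed (fockSubmodule K : Set (lp (FockColumn K) ∞)) := by
  refine isClosed_of_closure_subset fun x hx => ?_
  change Tendsto (fun t => ‖x t‖) cofinite (𝓝 0)
  rw [Metric.tendsto_nhds]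
  intro ε hε
  obtain ⟨y, hy, hxy⟩ := Metric.mem_closure_iff.1 hx (ε / 2) (by positivity)
  have hy' : Tendsto (fun t => ‖y t‖) cofinite (𝓝 0) := hy
  filter_upwards [(Metric.tendsto_nhds.1 hy') (ε / 2) (by positivity)] with t ht
  have h1 : ‖(x - y) t‖ ≤ ‖x - y‖ := lp.norm_apply_le_norm ENNReal.top_ne_zero (x - y) t
  have h2 : ‖x t‖ ≤ ‖(x - y) t‖ + ‖y t‖ := by
    have := norm_add_le (x t - y t) (y t)
    rwa [sub_add_cancel] at this
  rw [dist_eq_norm] at hxy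
  simp only [dist_zero_right, norm_norm] at ht ⊢
  linarith

instance : CompleteSpace (Fock K) := (isClosed_fockSubmodule (K := K)).completeSpace_coe

/-- Constructor for bounded operators on the Fock module from their matrix action. -/
noncomputable def mkOp (f : Fock K → ∀ t s, L s t)
    (hadd : ∀ x y t s, f (x + y) t s = f x t s + f y t s)
    (hsmul : ∀ (c : ℂ) x t s, f (c • x) t s = c • f x t s)
    (hmem : ∀ x t s, f x t s ∈ K.hom s t)
    (hsum : ∀ x t, Summable fun s => ip (f x t s) (f x t s))
    (C : ℝ) (hC : 0 ≤ C)
    (hle : ∀ x t, ∑' s, ip (f x t s) (f x t s) ≤ (C ^ 2) • FockColumn.inner (x.col t) (x.col t)) :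
    Fock K →L[ℂ] Fock K :=
  let g : ∀ (x : Fock K) (t : Ob), FockColumn K t := fun x t => ⟨f x t, hmem x t, hsum x t⟩
  have hg : ∀ x t, ‖g x t‖ ≤ C * ‖x.col t‖ := fun x t => by
    refine (sq_le_sq₀ (norm_nonneg _) (mul_nonneg hC (norm_nonneg _))).1 ?_
    have h1 := CStarAlgebra.norm_le_norm_of_nonneg_of_le (FockColumn.inner_self_nonneg (g x t))
      (hle x t)
    rw [norm_smul, ← FockColumn.norm_sq, ← FockColumn.norm_sq,
      Real.norm_of_nonneg (by positivity)] at h1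
    rw [mul_pow]
    exact h1
  LinearMap.mkContinuous
    { toFun := fun x => ⟨⟨g x, memℓp_infty ⟨C * ‖x‖, by
          rintro _ ⟨t, rfl⟩
          exact (hg x t).trans (mul_le_mul_of_nonneg_left (norm_col_le x t) hC)⟩⟩, by
          have h : Tendsto (fun t => C * ‖x.col t‖) cofinite (𝓝 0) := by
            have h0 : Tendsto (fun t => ‖x.col t‖) cofinite (𝓝 0) := x.2
            simpa using Tendsto.const_mul C h0
          exact squeeze_zero (fun _ => norm_nonneg _) (hg x) h⟩
      map_add' := fun x y => ext fun t s => hadd x y t s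
      map_smul' := fun c x => ext fun t s => hsmul c x t s }
    C (fun x => norm_le (mul_nonneg hC (norm_nonneg _)) fun t =>
      (hg x t).trans (mul_le_mul_of_nonneg_left (norm_col_le x t) hC))

/-- `S` and `S'` are adjoint to each other: `⟨S x, y⟩ = ⟨x, S' y⟩` for all `x`, `y`. -/
def IsAdjointPair (S S' : Fock K →L[ℂ] Fock K) : Prop :=
  ∀ (x y : Fock K) (t : Ob),
    FockColumn.inner ((S x).col t) (y.col t) = FockColumn.inner (x.col t) ((S' y).col t)

namespace IsAdjointPair

variable {S S' R R' : Fock K →L[ℂ] Fock K}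

lemma symm (h : IsAdjointPair S S') : IsAdjointPair S' S := fun x y t => by
  rw [← FockColumn.star_inner, ← h, FockColumn.star_inner]

lemma add (h : IsAdjointPair S S') (k : IsAdjointPair R R') :
    IsAdjointPair (S + R) (S' + R') := fun x y t => by
  have h1 := h x y t
  have h2 := k x y t
  have h3 := FockColumn.inner_add_left ((S x).col t) ((R x).col t) (y.col t)
  have h4 := FockColumn.inner_add_right (x.col t) ((S' y).col t) ((R' y).col t)
  rw [h1, h2] at h3
  exact h3.trans h4.symm

lemma smul (c : ℂ) (h : IsAdjointPair S S') : IsAdjointPair (c • S) (star c • S') :=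
  fun x y t => by
    have h1 := FockColumn.inner_smul_left c ((S x).col t) (y.col t)
    have h2 := FockColumn.inner_smul_right (star c) (x.col t) ((S' y).col t)
    rw [h x y t] at h1
    exact h1.trans h2.symm

lemma mul (h : IsAdjointPair S S') (k : IsAdjointPair R R') :
    IsAdjointPair (S * R) (R' * S') := fun x y t => (h (R x) y t).trans (k x (S' y) t)

lemma one : IsAdjointPair (1 : Fock K →L[ℂ] Fock K) 1 := fun _ _ _ => rfl

lemma unique (h : IsAdjointPair S S') (k : IsAdjointPair S R) : S' = R := by
  ext1 y
  rw [← sub_eq_zero]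
  refine Subtype.ext (lp.ext (funext fun t => ?_))
  set z : Fock K := S' y - R y
  have h1 : FockColumn.inner (z.col t) (z.col t) = 0 := by
    have e : z.col t = (S' y).col t + (-1 : ℂ) • (R y).col t := by
      rw [neg_one_smul, ← sub_eq_add_neg]; rfl
    rw [e, FockColumn.inner_add_right, FockColumn.inner_smul_right, ← e, ← h z y t, ← k z y t]
    simp
  exact FockColumn.inner_self_eq_zero.1 h1

lemma norm_le (h : IsAdjointPair S S') : ‖S‖ ≤ ‖S'‖ := by
  have key : ∀ x t, ‖(S x).col t‖ ^ 2 ≤ (‖x‖ * ‖S'‖) * ‖S x‖ := fun x t => by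
    rw [FockColumn.norm_sq, h x (S x) t]
    refine (FockColumn.norm_inner_le _ _).trans ?_
    rw [mul_assoc]
    exact mul_le_mul (norm_col_le _ _) ((norm_col_le _ _).trans (S'.le_opNorm _))
      (norm_nonneg _) (norm_nonneg _)
  refine S.opNorm_le_bound (norm_nonneg _) fun x => ?_
  have h1 : ‖S x‖ ≤ √((‖x‖ * ‖S'‖) * ‖S x‖) :=
    Fock.norm_le (Real.sqrt_nonneg _) fun t => Real.le_sqrt_of_sq_le (key x t)
  have h2 : ‖S x‖ ^ 2 ≤ (‖x‖ * ‖S'‖) * ‖S x‖ := by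
    rwa [Real.le_sqrt (norm_nonneg _) (by positivity)] at h1
  rcases (norm_nonneg (S x)).eq_or_lt with h0 | h0
  · rw [← h0]; positivity
  · nlinarith

lemma norm_eq (h : IsAdjointPair S S') : ‖S‖ = ‖S'‖ := le_antisymm h.norm_le h.symm.norm_le

end IsAdjointPair

/-- The algebra of adjointable operators on the Fock module. -/
def adjointable (K : HomIdeal L) : Subalgebra ℂ (Fock K →L[ℂ] Fock K) where
  carrier := {S | ∃ S', IsAdjointPair S S'}
  add_mem' := fun ⟨S', h⟩ ⟨R', k⟩ => ⟨S' + R', h.add k⟩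
  mul_mem' := fun ⟨S', h⟩ ⟨R', k⟩ => ⟨R' * S', h.mul k⟩
  algebraMap_mem' c := ⟨star c • 1, by
    rw [Algebra.algebraMap_eq_smul_one]
    exact IsAdjointPair.one.smul c⟩

end Fock

/-- The C*-algebra of adjointable operators on the Fock module of `K`. -/
def FockOp (K : HomIdeal L) : Type (max u v) := Fock.adjointable K

namespace FockOp

open Fock

variable {K : HomIdeal L}

noncomputable instance : NormedRing (FockOp K) := inferInstanceAs (NormedRing (adjointable K))

noncomputable instance : NormedAlgebra ℂ (FockOp K) :=
  inferInstanceAs (NormedAlgebra ℂ (adjointable K))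

noncomputable instance : Star (FockOp K) :=
  ⟨fun S => ⟨S.2.choose, S.1, S.2.choose_spec.symm⟩⟩

lemma isAdjointPair_star (S : FockOp K) : IsAdjointPair S.1 (star S).1 := S.2.choose_spec

lemma star_eq {S R : FockOp K} (h : IsAdjointPair S.1 R.1) : star S = R :=
  Subtype.ext ((isAdjointPair_star S).unique h)

noncomputable instance : StarRing (FockOp K) where
  star_involutive S := star_eq (isAdjointPair_star S).symm
  star_mul S R := star_eq ((isAdjointPair_star S).mul (isAdjointPair_star R))
  star_add S R := star_eq ((isAdjointPair_star S).add (isAdjointPair_star R))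

instance : StarModule ℂ (FockOp K) where
  star_smul c S := star_eq ((isAdjointPair_star S).smul c)

instance : CStarRing (FockOp K) where
  norm_mul_self_le S := by
    have key : ∀ x, ‖S.1 x‖ ^ 2 ≤ ‖star S * S‖ * ‖x‖ ^ 2 := fun x => by
      have h1 : ‖S.1 x‖ ≤ √(‖star S * S‖ * ‖x‖ ^ 2) := by
        refine Fock.norm_le (Real.sqrt_nonneg _) fun t => Real.le_sqrt_of_sq_le ?_
        rw [FockColumn.norm_sq, isAdjointPair_star S x (S.1 x) t]
        refine (FockColumn.norm_inner_le _ _).trans ?_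
        have h2 : ‖((star S).1 (S.1 x)).col t‖ ≤ ‖star S * S‖ * ‖x‖ :=
          (norm_col_le _ t).trans ((star S * S).1.le_opNorm x)
        have h3 := norm_col_le x t
        have h4 := norm_nonneg (x.col t)
        have h5 := norm_nonneg (((star S).1 (S.1 x)).col t)
        calc ‖x.col t‖ * ‖((star S).1 (S.1 x)).col t‖ ≤ ‖x‖ * (‖star S * S‖ * ‖x‖) := by gcongr
          _ = _ := by ring
      rwa [Real.le_sqrt (norm_nonneg _) (by positivity)] at h1
    have h1 : ‖S‖ ≤ √‖star S * S‖ := by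
      refine S.1.opNorm_le_bound (Real.sqrt_nonneg _) fun x => ?_
      refine (sq_le_sq₀ (norm_nonneg _) (by positivity)).1 ?_
      rw [mul_pow, Real.sq_sqrt (norm_nonneg _)]
      exact key x
    rw [← sq]
    rwa [Real.le_sqrt (norm_nonneg _) (norm_nonneg _)] at h1

lemma norm_star' (S : FockOp K) : ‖star S‖ = ‖S‖ := (isAdjointPair_star S).norm_eq.symm

lemma isClosed_adjointable : IsClosed (adjointable K : Set (Fock K →L[ℂ] Fock K)) := by
  refine IsSeqClosed.isClosed fun S R hS hR => ?_
  let S' : ℕ → FockOp K := fun n => ⟨S n, hS n⟩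
  have hc : CauchySeq fun n => (star (S' n)).1 := by
    have h := hR.cauchySeq
    rw [Metric.cauchySeq_iff] at h ⊢
    intro ε hε
    obtain ⟨N, hN⟩ := h ε hε
    refine ⟨N, fun m hm n hn => ?_⟩
    have h1 := hN m hm n hn
    rw [dist_eq_norm] at h1 ⊢
    have h2 : ‖star (S' m - S' n)‖ = ‖S' m - S' n‖ := norm_star' _
    rw [star_sub] at h2
    exact lt_of_eq_of_lt h2 h1
  obtain ⟨R', hR'⟩ := cauchySeq_tendsto_of_complete hc
  refine ⟨R', fun x y t => ?_⟩
  have hcol : ∀ (G : ℕ → (Fock K →L[ℂ] Fock K)) (G' : Fock K →L[ℂ] Fock K) (z : Fock K),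
      Tendsto G atTop (𝓝 G') → Tendsto (fun n => ‖(G n z).col t - (G' z).col t‖) atTop (𝓝 0) := by
    intro G G' z hG
    have h1 : Tendsto (fun n => ‖G n - G'‖ * ‖z‖) atTop (𝓝 0) := by
      simpa using (tendsto_iff_norm_sub_tendsto_zero.1 hG).mul_const ‖z‖
    refine squeeze_zero (fun _ => norm_nonneg _) (fun n => ?_) h1
    exact (norm_col_le (G n z - G' z) t).trans ((G n - G').le_opNorm z)
  have hsub : ∀ (a b : FockColumn K t), a - b = a + (-1 : ℂ) • b := fun a b => by
    rw [neg_one_smul, sub_eq_add_neg]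
  have h1 : Tendsto (fun n => FockColumn.inner ((S n x).col t) (y.col t)) atTop
      (𝓝 (FockColumn.inner ((R x).col t) (y.col t))) := by
    rw [tendsto_iff_norm_sub_tendsto_zero]
    have h := (hcol S R x hR).mul_const ‖y.col t‖
    rw [zero_mul] at h
    refine squeeze_zero (fun _ => norm_nonneg _) (fun n => ?_) h
    refine le_trans (le_of_eq ?_) (FockColumn.norm_inner_le _ _)
    rw [hsub, FockColumn.inner_add_left, FockColumn.inner_smul_left]
    simp [sub_eq_add_neg]
  have h2 : Tendsto (fun n => FockColumn.inner (x.col t) (((star (S' n)).1 y).col t)) atTop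
      (𝓝 (FockColumn.inner (x.col t) ((R' y).col t))) := by
    rw [tendsto_iff_norm_sub_tendsto_zero]
    have h := (hcol _ R' y hR').const_mul ‖x.col t‖
    rw [mul_zero] at h
    refine squeeze_zero (fun _ => norm_nonneg _) (fun n => ?_) h
    refine le_trans (le_of_eq ?_) (FockColumn.norm_inner_le _ _)
    rw [hsub, FockColumn.inner_add_right, FockColumn.inner_smul_right]
    simp [sub_eq_add_neg]
  refine tendsto_nhds_unique h1 (h2.congr fun n => ?_)
  exact (isAdjointPair_star (S' n) x y t).symm

instance : CompleteSpace (FockOp K) :=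
  (isClosed_adjointable (K := K)).completeSpace_coe

noncomputable instance : CStarAlgebra (FockOp K) where

noncomputable instance : PartialOrder (FockOp K) := CStarAlgebra.spectralOrder _

instance : StarOrderedRing (FockOp K) := CStarAlgebra.spectralOrderedRing _

lemma inner_apply_self_le (S : FockOp K) (x : Fock K) (t : Ob) :
    FockColumn.inner ((S.1 x).col t) ((S.1 x).col t)
      ≤ (‖S‖ ^ 2) • FockColumn.inner (x.col t) (x.col t) := by
  have h0 : 0 ≤ algebraMap ℝ (FockOp K) (‖S‖ ^ 2) - star S * S :=
    sub_nonneg.2 CStarAlgebra.star_mul_le_algebraMap_norm_sq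
  obtain ⟨R, hR⟩ := CStarAlgebra.nonneg_iff_eq_star_mul_self.1 h0
  have h1 := FockColumn.inner_self_nonneg ((R.1 x).col t)
  rw [isAdjointPair_star R x (R.1 x) t] at h1
  have h2 : (star R).1 (R.1 x) = ((‖S‖ ^ 2 : ℝ) : ℂ) • x + (-1 : ℂ) • (star S).1 (S.1 x) := by
    have h3 : (star R * R).1 x = (algebraMap ℝ (FockOp K) (‖S‖ ^ 2) - star S * S).1 x := by
      rw [hR]
    rw [Algebra.algebraMap_eq_smul_one] at h3
    rw [neg_one_smul, ← sub_eq_add_neg]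
    exact h3
  have h4 : ((star R).1 (R.1 x)).col t
      = ((‖S‖ ^ 2 : ℝ) : ℂ) • x.col t + (-1 : ℂ) • ((star S).1 (S.1 x)).col t := by rw [h2]; rfl
  rw [h4, FockColumn.inner_add_right, FockColumn.inner_smul_right, FockColumn.inner_smul_right,
    ← isAdjointPair_star S x (S.1 x) t, neg_one_smul, ← sub_eq_add_neg, sub_nonneg] at h1
  exact h1

end FockOp

end Fock

/-! ## Right LCM semigroups and right-tensor C*-precategories -/

/-- The principal right ideal `pP`. -/
def principalRightIdeal {P : Type u} [Monoid P] (p : P) : Set P := {w | ∃ s, w = p * s}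

/-- Clifford's condition: the intersection of two principal right ideals is empty or a principal
right ideal. A *right LCM semigroup* is a left cancellative monoid with this property. -/
def IsRightLCM (P : Type u) [Monoid P] : Prop :=
  ∀ p q : P, principalRightIdeal p ∩ principalRightIdeal q = ∅ ∨
    ∃ r, principalRightIdeal p ∩ principalRightIdeal q = principalRightIdeal r

/-- A *right tensoring* on a C*-precategory whose objects form a monoid `P`: a semigroup of
endomorphisms `a ↦ a ⊗ 1ᵣ` mapping `L p q` to `L (p * r) (q * r)`.

To avoid transport along equalities of objects, the target objects `p' = p * r` and `q' = q * r`
are given as variables together with proofs of these equalities. -/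
class RightTensoring {P : Type u} [Monoid P] (L : P → P → Type v)
    [∀ p q, NormedAddCommGroup (L p q)] [∀ p q, NormedSpace ℂ (L p q)]
    [∀ p q, CompleteSpace (L p q)] [CStarPrecategory L] where
  /-- The map `a ↦ a ⊗ 1ᵣ`. -/
  tensor (r : P) {p q p' q' : P} (hp : p * r = p') (hq : q * r = q') : L p q →ₗ[ℂ] L p' q'
  tensor_comp (r : P) {p q s p' q' s' : P} (hp : p * r = p') (hq : q * r = q') (hs : s * r = s')
    (a : L p q) (b : L q s) :
    tensor r hp hs (comp a b) = comp (tensor r hp hq a) (tensor r hq hs b)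
  tensor_adj (r : P) {p q p' q' : P} (hp : p * r = p') (hq : q * r = q') (a : L p q) :
    tensor r hq hp (adj a) = adj (tensor r hp hq a)
  tensor_one {p q : P} (a : L p q) : tensor 1 (mul_one p) (mul_one q) a = a
  tensor_tensor (r s : P) {p q p' q' p'' q'' : P} (hp : p * r = p') (hq : q * r = q')
    (hp' : p' * s = p'') (hq' : q' * s = q'') (a : L p q) :
    tensor s hp' hq' (tensor r hp hq a)
      = tensor (r * s) (by rw [← mul_assoc, hp, hp']) (by rw [← mul_assoc, hq, hq']) a

section Fock

variable {P : Type u} [Monoid P] {L : P → P → Type v}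
    [∀ p q, NormedAddCommGroup (L p q)] [∀ p q, NormedSpace ℂ (L p q)]
    [∀ p q, CompleteSpace (L p q)] [CStarPrecategory L] [RightTensoring L]

open RightTensoring

lemma norm_tensor_le (r : P) {p q p' q' : P} (hp : p * r = p') (hq : q * r = q') (a : L p q) :
    ‖tensor r hp hq a‖ ≤ ‖a‖ := by
  let φ : Diag L q →⋆ₙₐ[ℂ] Diag L q' :=
    { toFun := fun d => tensor (L := L) r hq hq d
      map_smul' := fun c d => (tensor (L := L) r hq hq).map_smul c d
      map_zero' := (tensor (L := L) r hq hq).map_zero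
      map_add' := fun c d => (tensor (L := L) r hq hq).map_add c d
      map_mul' := fun c d => tensor_comp (L := L) r hq hq hq c d
      map_star' := fun d => tensor_adj (L := L) r hq hq d }
  have h1 : φ (ip a a) = ip (tensor r hp hq a) (tensor r hp hq a) :=
    (tensor_comp (L := L) r hq hp hq (adj a) a).trans (by rw [tensor_adj]; rfl)
  have h2 := NonUnitalStarAlgHom.norm_apply_le φ (ip a a)
  rw [h1, norm_ip_self, norm_ip_self] at h2
  exact (sq_le_sq₀ (norm_nonneg _) (norm_nonneg _)).1 h2

namespace HomIdeal

/-- `K` is *well-aligned*: `(a ⊗ 1_{p⁻¹r}) (b ⊗ 1_{q⁻¹r}) ∈ K r r` for `a ∈ K p p`, `b ∈ K q q`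
whenever `pP ∩ qP = rP`. Here `x = p⁻¹r` and `y = q⁻¹r`. -/
def WellAligned (K : HomIdeal L) : Prop :=
  ∀ (p q r x y : P) (hx : p * x = r) (hy : q * y = r),
    principalRightIdeal p ∩ principalRightIdeal q = principalRightIdeal r →
    ∀ a ∈ K.hom p p, ∀ b ∈ K.hom q q, comp (tensor x hx hx a) (tensor y hy hy b) ∈ K.hom r r

/-- The hom-spaces of the right-tensor C*-precategory `L_K` generated by a well-aligned ideal `K`:
`L_K p q` is the closed linear span of all `a ⊗ 1ᵣ` with `a ∈ K s t`, `s * r = p`, `t * r = q`. -/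
def generated (K : HomIdeal L) (p q : P) : Submodule ℂ (L p q) :=
  (Submodule.span ℂ {b | ∃ (s t r : P) (hs : s * r = p) (ht : t * r = q),
    ∃ a ∈ K.hom s t, b = tensor r hs ht a}).topologicalClosure

/-- `K` is *essential* in the precategory with hom-spaces `M p q ⊇ K p q`: for every object `p`,
the ideal `K p p` of the C*-algebra `M p p` has trivial annihilator. -/
def IsEssentialIn (K : HomIdeal L) (M : ∀ p q : P, Submodule ℂ (L p q)) : Prop :=
  ∀ p : P, ∀ a ∈ M p p, (∀ k ∈ K.hom p p, comp a k = 0) → a = 0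

end HomIdeal

/-! ## Fock operators -/

section Cancel

variable [IsLeftCancelMul P]

open Classical in
/-- The vector with components `y_{p r} = (a ⊗ 1ᵣ) x_{q r}` for `r ∈ R`, and zero elsewhere. -/
noncomputable def fockFun (R : Set P) {p q : P} (a : L p q) {t : P} (x : ∀ s, L s t) (w : P) :
    L w t :=
  if h : ∃ r ∈ R, p * r = w then
    comp (tensor h.choose h.choose_spec.2 rfl a) (x (q * h.choose))
  else 0

lemma fockFun_mul (R : Set P) {p q : P} (a : L p q) {t : P} (x : ∀ s, L s t) {r : P}
    (hr : r ∈ R) : fockFun R a x (p * r) = comp (tensor r rfl rfl a) (x (q * r)) := by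
  have h : ∃ r' ∈ R, p * r' = p * r := ⟨r, hr, rfl⟩
  have key : ∀ (r' : P) (h' : p * r' = p * r),
      comp (tensor r' h' rfl a) (x (q * r')) = comp (tensor r rfl rfl a) (x (q * r)) := by
    intro r' h'
    obtain rfl := mul_left_cancel h'
    rfl
  rw [fockFun, dif_pos h]
  exact key _ _

lemma fockFun_of_notMem (R : Set P) {p q : P} (a : L p q) {t : P} (x : ∀ s, L s t) {w : P}
    (hw : ¬ ∃ r ∈ R, p * r = w) : fockFun R a x w = 0 := dif_neg hw

lemma fockFun_cases (R : Set P) {p q : P} (a : L p q) {t : P} (w : P) :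
    (∃ r ∈ R, ∃ h : p * r = w, ∀ x : ∀ s, L s t,
      fockFun R a x w = comp (tensor r h rfl a) (x (q * r))) ∨
    (∀ x : ∀ s, L s t, fockFun R a x w = 0) := by
  by_cases hw : ∃ r ∈ R, p * r = w
  · obtain ⟨r, hr, rfl⟩ := hw
    exact Or.inl ⟨r, hr, rfl, fun x => fockFun_mul R a x hr⟩
  · exact Or.inr fun x => fockFun_of_notMem R a x hw

lemma fockFun_mem (K : HomIdeal L) (R : Set P) {p q : P} (a : L p q) {t : P}
    (x : FockColumn K t) (w : P) : fockFun R a x w ∈ K.hom w t := by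
  rcases fockFun_cases R a (t := t) w with ⟨r, hr, h, hf⟩ | hf
  · rw [hf]; exact K.comp_mem_left _ (x.mem _)
  · rw [hf]; exact zero_mem _

lemma fockFun_range (R : Set P) {p q : P} (a : L p q) {t : P} (x : ∀ s, L s t) {w : P}
    (hw : w ∉ Set.range fun r : R => p * (r : P)) : fockFun R a x w = 0 :=
  fockFun_of_notMem R a x fun ⟨r, hr, h⟩ => hw ⟨⟨r, hr⟩, h⟩

lemma mul_coe_injective (R : Set P) (p : P) : Function.Injective fun r : R => p * (r : P) :=
  fun _ _ h => Subtype.ext (mul_left_cancel h)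

lemma fockFun_summable {K : HomIdeal L} (R : Set P) {p q : P} (a : L p q) {t : P}
    (x : FockColumn K t) :
    (Summable fun w => ip (fockFun R a x w) (fockFun R a x w)) ∧
    ∑' w, ip (fockFun R a x w) (fockFun R a x w) ≤ (‖a‖ ^ 2) • FockColumn.inner x x := by
  have hsupp : ∀ w ∉ Set.range (fun r : R => p * (r : P)),
      ip (fockFun R a x w) (fockFun R a x w) = 0 := fun w hw => by
    rw [fockFun_range R a x hw, ip_zero_left]
  have hle : ∀ r : R, ip (fockFun R a x (p * r)) (fockFun R a x (p * r))
      ≤ (‖a‖ ^ 2) • ip (x (q * r)) (x (q * r)) := fun r => by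
    rw [fockFun_mul R a x r.2]
    exact ip_comp_self_le _ _ (norm_tensor_le _ _ _ _)
  have hg : Summable fun r : R => (‖a‖ ^ 2) • ip (x (q * r)) (x (q * r)) :=
    ((x.summable x).comp_injective (mul_coe_injective R q)).const_smul (‖a‖ ^ 2)
  have hf : Summable fun r : R => ip (fockFun R a x (p * r)) (fockFun R a x (p * r)) :=
    summable_of_nonneg_of_le (fun _ => ip_self_nonneg _) hle hg
  refine ⟨((mul_coe_injective R p).summable_iff hsupp).1 hf, ?_⟩
  have hsupp' : Function.support (fun w => ip (fockFun R a x w) (fockFun R a x w)) ⊆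
      Set.range (fun r : R => p * (r : P)) := fun w hw => by
    by_contra h
    exact hw (hsupp w h)
  rw [← (mul_coe_injective R p).tsum_eq hsupp']
  refine (hf.tsum_le_tsum hle hg).trans ?_
  refine le_of_eq_of_le (Summable.tsum_const_smul (‖a‖ ^ 2)
    ((x.summable x).comp_injective (mul_coe_injective R q))) ?_
  refine smul_le_smul_of_nonneg_left ?_ (sq_nonneg _)
  refine Summable.tsum_le_of_sum_le
    ((x.summable x).comp_injective (mul_coe_injective R q)) fun F => ?_
  have := x.sum_le_inner_self (F.map ⟨_, mul_coe_injective R q⟩)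
  rwa [Finset.sum_map] at this

lemma fockFun_adjoint {K : HomIdeal L} (R : Set P) {p q : P} (a : L p q) {t : P}
    (x y : FockColumn K t) :
    ∑' w, ip (fockFun R a x w) (y w) = ∑' w, ip (x w) (fockFun R (adj a) y w) := by
  have h1 : Function.support (fun w => ip (fockFun R a x w) (y w)) ⊆
      Set.range (fun r : R => p * (r : P)) := fun w hw => by
    by_contra h
    exact hw (by simp only [fockFun_range R a x h, ip_zero_left])
  have h2 : Function.support (fun w => ip (x w) (fockFun R (adj a) y w)) ⊆
      Set.range (fun r : R => q * (r : P)) := fun w hw => by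
    by_contra h
    exact hw (by simp only [fockFun_range R (adj a) y h, ip_zero_right])
  rw [← (mul_coe_injective R p).tsum_eq h1, ← (mul_coe_injective R q).tsum_eq h2]
  refine tsum_congr fun r => ?_
  rw [fockFun_mul R a x r.2, fockFun_mul R (adj a) y r.2, ip_comp_left, tensor_adj]

variable (K : HomIdeal L)

/-- The bounded operator on the Fock module underlying `fockOp`. -/
noncomputable def fockCLM (R : Set P) {p q : P} (a : L p q) : Fock K →L[ℂ] Fock K :=
  Fock.mkOp (fun x t => fockFun R a (x.col t))
    (fun x y t w => by
      rcases fockFun_cases R a (t := t) w with ⟨r, hr, h, hf⟩ | hf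
      · rw [hf, hf, hf]; exact comp_add _ _ _
      · rw [hf, hf, hf, add_zero])
    (fun c x t w => by
      rcases fockFun_cases R a (t := t) w with ⟨r, hr, h, hf⟩ | hf
      · rw [hf, hf]; exact comp_smul _ _ _
      · rw [hf, hf, smul_zero])
    (fun x t w => fockFun_mem K R a (x.col t) w)
    (fun x t => (fockFun_summable R a (x.col t)).1)
    ‖a‖ (norm_nonneg a) (fun x t => (fockFun_summable R a (x.col t)).2)

/-- For `a ∈ L p q` and `R ⊆ P`, the adjointable operator `⨁_{r ∈ R, t ∈ P} T_{p,q}^{qr,t}(a)` on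
the Fock module of `K`, where `T_{p,q}^{qr,t}(a) : K (q * r) t → K (p * r) t` is left
multiplication by `a ⊗ 1ᵣ`. -/
noncomputable def fockOp (R : Set P) {p q : P} (a : L p q) : FockOp K :=
  ⟨fockCLM K R a, fockCLM K R (adj a), fun x y t => fockFun_adjoint R a (x.col t) (y.col t)⟩

/-- The (extended) *Fock representation*: `T(a) x = (a ⊗ 1_{q⁻¹s}) x` for `x ∈ K s t`, `s ∈ qP`,
and `T(a) x = 0` for `x ∈ K s t`, `s ∉ qP`, where `a ∈ L p q`. -/
noncomputable def fockRep {p q : P} (a : L p q) : FockOp K := fockOp K Set.univ a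

/-- The operator `⨁ T_{p,q}^{w,t}(a)` over all `t` and all `w ∈ pP ∩ qP` with `p⁻¹w = q⁻¹w`, that
is, over all `w = p r = q r`. -/
noncomputable def fockDiag {p q : P} (a : L p q) : FockOp K := fockOp K {r | p * r = q * r} a

/-- The *reduced Nica–Toeplitz algebra* of `K`: the C*-subalgebra of the adjointable operators on
the Fock module generated by all `T(a)` with `a ∈ K p q`. -/
noncomputable def reducedNT : NonUnitalStarSubalgebra ℂ (FockOp K) :=
  (NonUnitalStarAlgebra.adjoin ℂ
    {S | ∃ (p q : P) (a : L p q), a ∈ K.hom p q ∧ S = fockRep K a}).topologicalClosure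

lemma fockRep_mem {p q : P} {a : L p q} (ha : a ∈ K.hom p q) : fockRep K a ∈ reducedNT K :=
  NonUnitalStarSubalgebra.le_topologicalClosure _
    (NonUnitalStarAlgebra.subset_adjoin ℂ _ ⟨p, q, a, ha, rfl⟩)

/-- The *transcendental core* of `K`. -/
noncomputable def transCore : Submodule ℂ (FockOp K) :=
  (Submodule.span ℂ
    {S | ∃ (p q : P) (a : L p q), a ∈ K.hom p q ∧ S = fockDiag K a}).topologicalClosure

lemma fockDiag_mem {p q : P} {a : L p q} (ha : a ∈ K.hom p q) : fockDiag K a ∈ transCore K :=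
  Submodule.le_topologicalClosure _ (Submodule.subset_span ⟨p, q, a, ha, rfl⟩)

end Cancel

end Fock

/-! ## The conditional expectation onto the diagonal operators -/

section Expectation

variable {Ob : Type u} {L : Ob → Ob → Type v}
    [∀ σ ρ, NormedAddCommGroup (L σ ρ)] [∀ σ ρ, NormedSpace ℂ (L σ ρ)]
    [∀ σ ρ, CompleteSpace (L σ ρ)] [CStarPrecategory L] {K : HomIdeal L}

open Classical in
/-- The projection `Q_w` of the Fock module onto `⨁ₜ K w t`. -/
noncomputable def rangeProj (K : HomIdeal L) (w : Ob) : Fock K →L[ℂ] Fock K :=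
  have h : ∀ (x : Fock K) (t s : Ob),
      ip (if s = w then x.col t s else 0) (if s = w then x.col t s else 0)
        ≤ ip (x.col t s) (x.col t s) := fun x t s => by
    split_ifs
    · exact le_rfl
    · rw [ip_zero_left]; exact ip_self_nonneg _
  have hs : ∀ (x : Fock K) (t : Ob), Summable fun s =>
      ip (if s = w then x.col t s else 0) (if s = w then x.col t s else 0) := fun x t =>
    summable_of_nonneg_of_le (fun _ => ip_self_nonneg _) (h x t) ((x.col t).summable (x.col t))
  Fock.mkOp (fun x t s => if s = w then x.col t s else 0)
    (fun x y t s => by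
      split_ifs
      · rfl
      · exact (add_zero (0 : L s t)).symm)
    (fun c x t s => by
      split_ifs
      · rfl
      · exact (smul_zero c).symm)
    (fun x t s => by
      split_ifs
      · exact (x.col t).mem s
      · exact zero_mem _)
    hs 1 zero_le_one
    (fun x t => by
      rw [one_pow, one_smul]
      exact (hs x t).tsum_le_tsum (h x t) ((x.col t).summable (x.col t)))

lemma inner_rangeProj_left (w : Ob) (x y : Fock K) (t : Ob) :
    FockColumn.inner ((rangeProj K w x).col t) (y.col t) = ip (x.col t w) (y.col t w) := by
  classical
  refine (tsum_eq_single w fun s hs => ?_).trans ?_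
  · have : (rangeProj K w x).col t s = 0 := if_neg hs
    rw [this, ip_zero_left]
  · have : (rangeProj K w x).col t w = x.col t w := if_pos rfl
    rw [this]

lemma inner_rangeProj_right (w : Ob) (x y : Fock K) (t : Ob) :
    FockColumn.inner (x.col t) ((rangeProj K w y).col t) = ip (x.col t w) (y.col t w) := by
  rw [← FockColumn.star_inner, inner_rangeProj_left, star_ip]

lemma diagPart_le (S : FockOp K) (x : Fock K) (t w : Ob) :
    ip ((S.1 (rangeProj K w x)).col t w) ((S.1 (rangeProj K w x)).col t w)
      ≤ (‖S‖ ^ 2) • ip (x.col t w) (x.col t w) := by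
  refine (((S.1 (rangeProj K w x)).col t).ip_le_inner_self w).trans ?_
  refine (FockOp.inner_apply_self_le S (rangeProj K w x) t).trans (le_of_eq ?_)
  have : (rangeProj K w x).col t w = x.col t w := if_pos rfl
  rw [inner_rangeProj_right, this]

/-- The bounded operator on the Fock module underlying `expectation`. -/
noncomputable def diagCLM (S : FockOp K) : Fock K →L[ℂ] Fock K :=
  have hs : ∀ (x : Fock K) (t : Ob), Summable fun w =>
      ip ((S.1 (rangeProj K w x)).col t w) ((S.1 (rangeProj K w x)).col t w) := fun x t =>
    summable_of_nonneg_of_le (fun _ => ip_self_nonneg _) (diagPart_le S x t)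
      (((x.col t).summable (x.col t)).const_smul (‖S‖ ^ 2))
  Fock.mkOp (fun x t w => (S.1 (rangeProj K w x)).col t w)
    (fun x y t w => by rw [map_add, map_add]; rfl)
    (fun c x t w => by rw [map_smul, map_smul]; rfl)
    (fun x t w => ((S.1 (rangeProj K w x)).col t).mem w)
    hs ‖S‖ (norm_nonneg S)
    (fun x t => ((hs x t).tsum_le_tsum (diagPart_le S x t)
        (((x.col t).summable (x.col t)).const_smul (‖S‖ ^ 2))).trans
      (le_of_eq (Summable.tsum_const_smul (‖S‖ ^ 2) ((x.col t).summable (x.col t)))))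

/-- The conditional expectation `E(S) = ∑_w Q_w S Q_w`: the component of `E(S) x` in `K w t` is the
component of `S (Q_w x)` in `K w t`. Its restriction to the reduced Nica–Toeplitz algebra of `K` is
the *transcendental conditional expectation*. -/
noncomputable def expectation (S : FockOp K) : FockOp K :=
  ⟨diagCLM S, diagCLM (star S), fun x y t => tsum_congr fun w => by
    have h := FockOp.isAdjointPair_star S (rangeProj K w x) (rangeProj K w y) t
    rw [inner_rangeProj_left, inner_rangeProj_right] at h
    exact h⟩

end Expectation

end NicaToeplitz

open NicaToeplitz

/-!
Write `T(a)` and `S(a)` for the Fock operators of `K` and of `L`. The Fock module of `K` is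
invariant under every `S(a)` with `a` in `K`, and `S(a)` restricts to `T(a)` there. So the
embedding `ι` exists once restriction is isometric on the C*-algebra generated by these `S(a)`. To
treat both algebras symmetrically, all computations take place in the product of the two
C*-algebras of adjointable operators: the pairs `(S(a), T(a))` span a *-algebra by Nica covariance
(`fockPair_mul`) and well-alignedness (`HomIdeal.WellAligned.comp_tensor_mem`), and its closure is
the graph of `ι` as soon as its second projection is injective.

Injectivity reduces to diagonal operators: the conditional expectation `E` is faithful
(`eq_zero_of_expectation_star_mul_self`), compatible with restriction, and sends `(S(a), T(a))`
to `(S_Δ(a), T_Δ(a))` (`expectation_fockRep`). If `(X, 0)` lies in the closed *-algebra of pairs,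
then `(E(X* X), 0)` lies in the closed span of the diagonal pairs, so it suffices that restriction
is isometric on that span. For this, the diagonal pairs are placed in a *-algebra of pairs,
depending on the hypothesis (`exists_isometric_diagonal_algebra`).

* If `K` is essential in `L_K`, the rows of a diagonal operator are left multiplications by
  elements of the C*-algebras `L_K w w`, which act faithfully, hence isometrically, on the rows of
  the Fock module of `K` (`norm_le_norm_rowHom`).
* If `P` is cancellative, then `T_Δ(a)` is `T(a)` for `a ∈ K p p` and zero off the diagonal. A
  linear combination of such operators involves finitely many principal right ideals, which
  generate a finite family closed under nonempty intersections. The coefficients can be recovered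
  one after another, starting with the largest ideals, and this bounds `X` by a constant multiple
  of its restriction (`exists_norm_coeff_le`). On a *-algebra of pairs such a bound improves to
  the constant one, because injective *-homomorphisms of C*-algebras are isometric.

The isometry `κ` has the closed span of the diagonal pairs as its graph. That it agrees with `ι`
is not formal when `P` is not cancellative: it follows from faithfulness of `E`, applied to the
difference of the two candidates (`eq_of_mem_pairAlgebra_of_mem_corePairs`).
-/

namespace NicaToeplitz

open Filter Topology CStarPrecategory RightTensoring
open scoped ENNReal

/-! ### Subalgebras of products and their graphs -/

section Graph

/-- The linear span of a self-adjoint set that is closed under products up to linear combinations,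
as a *-subalgebra. -/
def spanStarSubalgebra {A : Type*} [NonUnitalRing A] [StarRing A] [Module ℂ A]
    [IsScalarTower ℂ A A] [SMulCommClass ℂ A A] [StarModule ℂ A] (s : Set A)
    (hmul : ∀ x ∈ s, ∀ y ∈ s, x * y ∈ Submodule.span ℂ s) (hstar : ∀ x ∈ s, star x ∈ s) :
    NonUnitalStarSubalgebra ℂ A where
  __ := Submodule.span ℂ s
  mul_mem' {a b} ha hb := by
    change a * b ∈ Submodule.span ℂ s
    change a ∈ Submodule.span ℂ s at ha
    change b ∈ Submodule.span ℂ s at hb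
    induction ha, hb using Submodule.span_induction₂ with
    | mem_mem x y hx hy => exact hmul x hx y hy
    | zero_left y _ => rw [zero_mul]; exact zero_mem _
    | zero_right x _ => rw [mul_zero]; exact zero_mem _
    | add_left x y z _ _ _ h h' => rw [add_mul]; exact add_mem h h'
    | add_right x y z _ _ _ h h' => rw [mul_add]; exact add_mem h h'
    | smul_left r x y _ _ h => rw [smul_mul_assoc]; exact Submodule.smul_mem _ _ h
    | smul_right r x y _ _ h => rw [mul_smul_comm]; exact Submodule.smul_mem _ _ h
  star_mem' {a} ha := by
    change star a ∈ Submodule.span ℂ s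
    change a ∈ Submodule.span ℂ s at ha
    induction ha using Submodule.span_induction with
    | mem x hx => exact Submodule.subset_span (hstar x hx)
    | zero => rw [star_zero]; exact zero_mem _
    | add x y _ _ h h' => rw [star_add]; exact add_mem h h'
    | smul r x _ h => rw [star_smul]; exact Submodule.smul_mem _ _ h

/-- An injective *-homomorphism of C*-algebras is isometric; here for the second projection of a
closed *-subalgebra of a product. -/
lemma norm_fst_le_of_snd_injective {A B : Type*} [NonUnitalCStarAlgebra A]
    [NonUnitalCStarAlgebra B] (D : NonUnitalStarSubalgebra ℂ (A × B))
    (hD : IsClosed (D : Set (A × B))) (hinj : ∀ z ∈ D, z.2 = 0 → z.1 = 0) :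
    ∀ z ∈ D, ‖z.1‖ ≤ ‖z.2‖ := by
  intro z hz
  let _ : NonUnitalCStarAlgebra D :=
    NonUnitalStarSubalgebra.nonUnitalCStarAlgebra D (h_closed := hD)
  let φ : D →⋆ₙₐ[ℂ] B :=
    (NonUnitalStarAlgHom.snd ℂ A B).comp (NonUnitalStarSubalgebraClass.subtype D)
  have hφ : Function.Injective φ := by
    rw [injective_iff_map_eq_zero]
    intro x hx
    exact Subtype.ext (Prod.ext (hinj x.1 x.2 hx) hx)
  have h := NonUnitalStarAlgHom.norm_map φ hφ ⟨z, hz⟩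
  exact (norm_fst_le z).trans h.symm.le

/-- On a *-subalgebra of a product of C*-algebras, any bound of the first component by the second
improves to a bound with constant one. -/
lemma norm_fst_le_of_le_mul {A B : Type*} [NonUnitalCStarAlgebra A]
    [NonUnitalCStarAlgebra B] (D : NonUnitalStarSubalgebra ℂ (A × B)) (C : ℝ)
    (hC : ∀ z ∈ D, ‖z.1‖ ≤ C * ‖z.2‖) : ∀ z ∈ D, ‖z.1‖ ≤ ‖z.2‖ := by
  have hcl : IsClosed {z : A × B | ‖z.1‖ ≤ C * ‖z.2‖} :=
    isClosed_le (by fun_prop) (by fun_prop)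
  have h : ∀ z ∈ D.topologicalClosure, ‖z.1‖ ≤ C * ‖z.2‖ := fun z hz =>
    closure_minimal (fun z hz => hC z hz) hcl hz
  intro z hz
  refine norm_fst_le_of_snd_injective _ D.isClosed_topologicalClosure (fun z hz h0 => ?_) z
    (D.le_topologicalClosure hz)
  have := h z hz
  rw [h0, norm_zero, mul_zero] at this
  exact norm_le_zero_iff.1 this

lemma norm_fst_le_of_mem_closure {A B : Type*} [NormedAddCommGroup A] [NormedAddCommGroup B]
    {D : Set (A × B)} (h : ∀ z ∈ D, ‖z.1‖ ≤ ‖z.2‖) : ∀ z ∈ closure D, ‖z.1‖ ≤ ‖z.2‖ :=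
  fun _ hz => closure_minimal h
    (isClosed_le (f := fun z : A × B => ‖z.1‖) (g := fun z => ‖z.2‖) (by fun_prop) (by fun_prop)) hz

lemma norm_snd_le_of_mem_closure {A B : Type*} [NormedAddCommGroup A] [NormedAddCommGroup B]
    {D : Set (A × B)} (h : ∀ z ∈ D, ‖z.2‖ ≤ ‖z.1‖) : ∀ z ∈ closure D, ‖z.2‖ ≤ ‖z.1‖ :=
  fun _ hz => closure_minimal h
    (isClosed_le (f := fun z : A × B => ‖z.2‖) (g := fun z => ‖z.1‖) (by fun_prop) (by fun_prop)) hz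

/-- A closed subspace of a product on which the two components have the same norm projects onto a
closed subspace. -/
lemma isClosed_image_snd {A B : Type*} [NormedAddCommGroup A] [NormedSpace ℂ A] [CompleteSpace A]
    [NormedAddCommGroup B] [NormedSpace ℂ B] [CompleteSpace B] (V : Submodule ℂ (A × B))
    (hV : IsClosed (V : Set (A × B))) (h : ∀ z ∈ V, ‖z.1‖ ≤ ‖z.2‖) :
    IsClosed (Prod.snd '' (V : Set (A × B))) := by
  have : CompleteSpace V := hV.completeSpace_coe
  let f : V →ₗ[ℂ] B := (LinearMap.snd ℂ A B).comp V.subtype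
  have hf : Isometry f := AddMonoidHomClass.isometry_of_norm f fun z => by
    refine le_antisymm (norm_snd_le z.1) ?_
    exact max_le (h z.1 z.2) le_rfl
  have := hf.isClosedEmbedding.isClosed_range
  convert this using 1
  ext y
  constructor
  · rintro ⟨z, hz, rfl⟩; exact ⟨⟨z, hz⟩, rfl⟩
  · rintro ⟨z, rfl⟩; exact ⟨z.1, z.2, rfl⟩

lemma graph_unique {A B : Type*} [NormedAddCommGroup A] [NormedSpace ℂ A]
    [NormedAddCommGroup B] [NormedSpace ℂ B] {V : Submodule ℂ (A × B)}
    (h : ∀ z ∈ V, ‖z.1‖ ≤ ‖z.2‖) {x x' : A} {y : B} (hx : (x, y) ∈ V) (hx' : (x', y) ∈ V) :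
    x = x' := by
  have := h _ (V.sub_mem hx hx')
  rw [Prod.mk_sub_mk, sub_self, norm_zero] at this
  exact sub_eq_zero.1 (norm_le_zero_iff.1 this)

/-- The linear isometry whose graph is contained in a given subspace. -/
lemma exists_linearIsometry_of_graph {A B : Type*} [NormedAddCommGroup A] [NormedSpace ℂ A]
    [NormedAddCommGroup B] [NormedSpace ℂ B] (V : Submodule ℂ (A × B))
    (h : ∀ z ∈ V, ‖z.1‖ ≤ ‖z.2‖) (h' : ∀ z ∈ V, ‖z.2‖ ≤ ‖z.1‖)
    (N : Submodule ℂ A) (M : Submodule ℂ B) (hN : ∀ z ∈ V, z.1 ∈ N)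
    (hM : ∀ y ∈ M, ∃ x, (x, y) ∈ V) :
    ∃ κ : M →ₗᵢ[ℂ] N, ∀ y : M, ((κ y : A), (y : B)) ∈ V := by
  choose! f hf using hM
  refine ⟨{ toFun := fun y => ⟨f y, hN _ (hf y y.2)⟩
            map_add' := fun y z => Subtype.ext ?_
            map_smul' := fun c y => Subtype.ext ?_
            norm_map' := fun y => ?_ }, fun y => hf y y.2⟩
  · exact graph_unique h (hf _ (y + z).2) (V.add_mem (hf y y.2) (hf z z.2))
  · exact graph_unique h (hf _ (c • y).2) (V.smul_mem c (hf y y.2))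
  · exact le_antisymm (h _ (hf y y.2)) (h' _ (hf y y.2))

/-- The isometric *-homomorphism whose graph is contained in a given *-subalgebra. -/
lemma exists_starAlgHom_of_graph {A B : Type*} [NonUnitalCStarAlgebra A]
    [NonUnitalCStarAlgebra B] (V : NonUnitalStarSubalgebra ℂ (A × B))
    (h : ∀ z ∈ V, ‖z.1‖ ≤ ‖z.2‖) (h' : ∀ z ∈ V, ‖z.2‖ ≤ ‖z.1‖)
    (N : NonUnitalStarSubalgebra ℂ A) (M : NonUnitalStarSubalgebra ℂ B) (hN : ∀ z ∈ V, z.1 ∈ N)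
    (hM : ∀ y ∈ M, ∃ x, (x, y) ∈ V) :
    ∃ ι : M →⋆ₙₐ[ℂ] N, Isometry ι ∧ ∀ y : M, ((ι y : A), (y : B)) ∈ V := by
  choose! f hf using hM
  have uniq : ∀ {x x' : A} {y : B}, (x, y) ∈ V → (x', y) ∈ V → x = x' := fun hx hx' =>
    graph_unique (V := V.toNonUnitalSubalgebra.toSubmodule) h hx hx'
  let ι : M →⋆ₙₐ[ℂ] N :=
    { toFun := fun y => ⟨f y, hN _ (hf y y.2)⟩
      map_smul' := fun c y =>
        Subtype.ext (uniq (hf _ (c • y).2) (SMulMemClass.smul_mem c (hf y y.2)))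
      map_zero' := Subtype.ext (uniq (hf _ (0 : M).2) V.zero_mem)
      map_add' := fun y z =>
        Subtype.ext (uniq (hf _ (y + z).2) (V.add_mem (hf y y.2) (hf z z.2)))
      map_mul' := fun y z =>
        Subtype.ext (uniq (hf _ (y * z).2) (V.mul_mem (hf y y.2) (hf z z.2)))
      map_star' := fun y => Subtype.ext (uniq (hf _ (star y).2) (star_mem (hf y y.2))) }
  refine ⟨ι, AddMonoidHomClass.isometry_of_norm ι fun y => ?_, fun y => hf y y.2⟩
  exact le_antisymm (h _ (hf y y.2)) (h' _ (hf y y.2))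

end Graph

/-! ### Approximate units in ideals -/

section Approx

/-- A self-adjoint `u` in the ideal generated by `h ≥ 0` with `(1 - u) h (1 - u)` small: the
function `t / (t + ε)` of `h`. The formula `u = h v + c h` shows that `u` lies in every ideal that
contains `h`. -/
lemma exists_approx_unit {A : Type*} [NonUnitalCStarAlgebra A] [PartialOrder A]
    [StarOrderedRing A] {h : A} (hh : 0 ≤ h) {ε : ℝ} (hε : 0 < ε) :
    ∃ (u v : A) (c : ℂ), star u = u ∧ u = h * v + c • h ∧
      ‖h - h * u - u * h + u * h * u‖ ≤ ε := by
  have hsa : IsSelfAdjoint h := .of_nonneg hh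
  have hden : ∀ t : ℝ, |t| + ε ≠ 0 := fun t => by positivity
  let g : ℝ → ℝ := fun t => t / (|t| + ε)
  let k : ℝ → ℝ := fun t => -(ε⁻¹ * (t / (|t| + ε)))
  have hg : Continuous g := by fun_prop (disch := exact hden _)
  have hk : Continuous k := by fun_prop (disch := exact hden _)
  have hg0 : g 0 = 0 := by simp [g]
  have hk0 : k 0 = 0 := by simp [k]
  have hid : cfcₙ (fun t : ℝ => t) h = h := cfcₙ_id' ℝ h
  refine ⟨cfcₙ g h, cfcₙ k h, ((ε⁻¹ : ℝ) : ℂ), cfcₙ_predicate g h, ?_, ?_⟩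
  · have e : (((ε⁻¹ : ℝ) : ℂ)) • h = (ε⁻¹ : ℝ) • h := rfl
    have e' : h * cfcₙ k h + (ε⁻¹ : ℝ) • h = cfcₙ (fun t => t * k t + ε⁻¹ • t) h := by
      rw [cfcₙ_add (fun t => t * k t) (fun t => ε⁻¹ • t) h, cfcₙ_mul (fun t => t) k h,
        cfcₙ_smul _ (fun t => t) h, hid]
    rw [e, e']
    refine cfcₙ_congr fun t ht => ?_
    have ht0 : 0 ≤ t := quasispectrum_nonneg_of_nonneg h hh t ht
    have := hden t
    simp only [g, k, abs_of_nonneg ht0, smul_eq_mul] at this ⊢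
    field_simp
    ring
  · have e : h - h * cfcₙ g h - cfcₙ g h * h + cfcₙ g h * h * cfcₙ g h
        = cfcₙ (fun t => t - t * g t - g t * t + g t * t * g t) h := by
      rw [cfcₙ_add (fun t => t - t * g t - g t * t) (fun t => g t * t * g t) h,
        cfcₙ_sub (fun t => t - t * g t) (fun t => g t * t) h,
        cfcₙ_sub (fun t => t) (fun t => t * g t) h, cfcₙ_mul (fun t => t) g h,
        cfcₙ_mul (fun t => g t * t) g h, cfcₙ_mul g (fun t => t) h, hid]
    rw [e]
    refine norm_cfcₙ_le fun t ht => ?_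
    have ht0 : 0 ≤ t := quasispectrum_nonneg_of_nonneg h hh t ht
    have hp : 0 < t + ε := by positivity
    have e2 : t - t * g t - g t * t + g t * t * g t = t * ε ^ 2 / (t + ε) ^ 2 := by
      simp only [g, abs_of_nonneg ht0]
      field_simp
      ring
    rw [e2, Real.norm_of_nonneg (by positivity), div_le_iff₀ (by positivity)]
    nlinarith [mul_nonneg hε.le ht0, mul_nonneg hε.le (mul_nonneg ht0 ht0), pow_pos hε 3]

end Approx

section Ideal

variable {Ob : Type u} {L : Ob → Ob → Type v}
    [∀ σ ρ, NormedAddCommGroup (L σ ρ)] [∀ σ ρ, NormedSpace ℂ (L σ ρ)]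
    [∀ σ ρ, CompleteSpace (L σ ρ)] [CStarPrecategory L]

/-- Right multiplication by a morphism, as a bounded linear map. -/
noncomputable def compRight {τ σ : Ob} (ρ : Ob) (b : L τ σ) : L ρ τ →L[ℂ] L ρ σ :=
  LinearMap.mkContinuous
    { toFun := fun a => comp a b
      map_add' := fun _ _ => add_comp _ _ _
      map_smul' := fun _ _ => smul_comp _ _ _ } ‖b‖
    fun a => (norm_comp_le a b).trans_eq (mul_comm _ _)

/-- Left multiplication by a morphism, as a bounded linear map. -/
noncomputable def compLeft {τ σ : Ob} (ρ : Ob) (a : L τ σ) : L σ ρ →L[ℂ] L τ ρ :=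
  LinearMap.mkContinuous
    { toFun := fun b => comp a b
      map_add' := fun _ _ => comp_add _ _ _
      map_smul' := fun _ _ => comp_smul _ _ _ } ‖a‖
    fun b => norm_comp_le a b

/-- The involution, as a conjugate-linear isometry. -/
noncomputable def adjIsometry (σ ρ : Ob) : L σ ρ →ₗᵢ⋆[ℂ] L ρ σ where
  toFun := adj
  map_add' := adj_add
  map_smul' := adj_smul
  norm_map' := norm_adj

lemma adj_sub {σ ρ : Ob} (a b : L σ ρ) : adj (a - b) = adj a - adj b :=
  (adjIsometry σ ρ).map_sub a b

lemma exists_comp_approx {s t : Ob} (x : L s t) {δ : ℝ} (hδ : 0 < δ) :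
    ∃ u : L t t, adj u = u ∧ (∃ (v : L t t) (c : ℂ),
      u = comp (comp (adj x) x) v + c • comp (adj x) x) ∧ ‖x - comp x u‖ < δ := by
  obtain ⟨u, v, c, hu, huv, hle⟩ :=
    exists_approx_unit (ip_self_nonneg x) (ε := (δ / 2) ^ 2) (by positivity)
  refine ⟨u, hu, ⟨v, c, huv⟩, ?_⟩
  have e : ip (x - ract x u) (x - ract x u)
      = ip x x - ip x x * u - u * ip x x + u * ip x x * u := by
    have e1 : ip (ract x u) x = u * ip x x := by
      rw [← star_ip, ip_ract, star_mul, star_ip, hu]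
    rw [ip_sub_left, ip_sub_right, ip_sub_right, ip_ract, ip_ract, e1]
    abel
  rw [← e, norm_ip_self] at hle
  have h2 := (sq_le_sq₀ (norm_nonneg _) (by positivity)).1 hle
  have h3 : ‖x - comp x u‖ ≤ δ / 2 := h2
  linarith

namespace HomIdeal

variable (K : HomIdeal L)

/-- Every `x` in an ideal is a limit of products `x u` with `u = u*` in the ideal. -/
lemma exists_comp_approx {s t : Ob} {x : L s t} (hx : x ∈ K.hom s t) {δ : ℝ} (hδ : 0 < δ) :
    ∃ u ∈ K.hom t t, adj u = u ∧ ‖x - comp x u‖ < δ := by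
  obtain ⟨u, hu, ⟨v, c, huv⟩, hle⟩ := NicaToeplitz.exists_comp_approx x hδ
  refine ⟨u, ?_, hu, hle⟩
  rw [huv]
  exact add_mem (K.comp_mem_right _ (K.comp_mem_left _ hx))
    (Submodule.smul_mem _ _ (K.comp_mem_left _ hx))

/-- Closed two-sided ideals are self-adjoint. -/
lemma adj_mem {s t : Ob} {x : L s t} (hx : x ∈ K.hom s t) : adj x ∈ K.hom t s := by
  refine (K.isClosed_hom t s).closure_subset (Metric.mem_closure_iff.2 fun δ hδ => ?_)
  obtain ⟨u, hu, hu', hle⟩ := K.exists_comp_approx hx hδ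
  refine ⟨comp u (adj x), K.comp_mem_right _ hu, ?_⟩
  rw [dist_eq_norm, ← hu', ← adj_comp, ← adj_sub, norm_adj]
  exact hle

lemma mem_closure_comp_right {s t : Ob} {x : L s t} (hx : x ∈ K.hom s t) :
    x ∈ closure {y | ∃ u ∈ K.hom t t, y = comp x u} := by
  refine Metric.mem_closure_iff.2 fun δ hδ => ?_
  obtain ⟨u, hu, -, hle⟩ := K.exists_comp_approx hx hδ
  exact ⟨_, ⟨u, hu, rfl⟩, by rwa [dist_eq_norm]⟩

lemma mem_closure_comp_left {s t : Ob} {x : L s t} (hx : x ∈ K.hom s t) :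
    x ∈ closure {y | ∃ u ∈ K.hom s s, y = comp u x} := by
  refine Metric.mem_closure_iff.2 fun δ hδ => ?_
  obtain ⟨u, hu, hu', hle⟩ := K.exists_comp_approx (K.adj_mem hx) hδ
  refine ⟨_, ⟨u, hu, rfl⟩, ?_⟩
  rw [dist_eq_norm, ← norm_adj, adj_sub, adj_comp, hu']
  exact hle

end HomIdeal

end Ideal

/-! ### Right tensoring and well-aligned ideals -/

section Tensor

variable {P : Type u} [Monoid P] {L : P → P → Type v}
    [∀ p q, NormedAddCommGroup (L p q)] [∀ p q, NormedSpace ℂ (L p q)]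
    [∀ p q, CompleteSpace (L p q)] [CStarPrecategory L] [RightTensoring L]

lemma continuous_tensor (r : P) {p q p' q' : P} (hp : p * r = p') (hq : q * r = q') :
    Continuous (tensor (L := L) r hp hq) :=
  AddMonoidHomClass.continuous_of_bound (tensor (L := L) r hp hq) 1 fun a => by
    rw [one_mul]; exact norm_tensor_le r hp hq a

namespace HomIdeal

variable {K : HomIdeal L}

/-- The defining property of well-aligned ideals extends from the diagonal to all hom-spaces, since
elements of ideals factor approximately through the diagonal. -/
lemma WellAligned.comp_tensor_mem (hK : K.WellAligned) {p q p' q' r x y p₁ q₁ : P}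
    (hx : q * x = r) (hy : p' * y = r) (hp₁ : p * x = p₁) (hq₁ : q' * y = q₁)
    (hr : principalRightIdeal q ∩ principalRightIdeal p' = principalRightIdeal r)
    {a : L p q} (ha : a ∈ K.hom p q) {b : L p' q'} (hb : b ∈ K.hom p' q') :
    comp (tensor x hp₁ hx a) (tensor y hy hq₁ b) ∈ K.hom p₁ q₁ := by
  have h1 : ∀ u ∈ K.hom q q, ∀ v ∈ K.hom p' p',
      comp (tensor x hp₁ hx (comp a u)) (tensor y hy hq₁ (comp v b)) ∈ K.hom p₁ q₁ := by
    intro u hu v hv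
    rw [tensor_comp x hp₁ hx hx, tensor_comp y hy hy hq₁, comp_assoc,
      ← comp_assoc (tensor x hx hx u)]
    exact K.comp_mem_left _ (K.comp_mem_right _ (hK q p' r x y hx hy hr u hu v hv))
  have h2 : ∀ u ∈ K.hom q q,
      comp (tensor x hp₁ hx (comp a u)) (tensor y hy hq₁ b) ∈ K.hom p₁ q₁ := by
    intro u hu
    refine (K.isClosed_hom p₁ q₁).closure_subset (map_mem_closure
      (f := fun b => comp (tensor x hp₁ hx (comp a u)) (tensor y hy hq₁ b))
      ((compLeft q₁ (tensor x hp₁ hx (comp a u))).continuous.comp (continuous_tensor y hy hq₁))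
      (K.mem_closure_comp_left hb) ?_)
    rintro _ ⟨v, hv, rfl⟩
    exact h1 u hu v hv
  refine (K.isClosed_hom p₁ q₁).closure_subset (map_mem_closure
    (f := fun a => comp (tensor x hp₁ hx a) (tensor y hy hq₁ b))
    ((compRight p₁ (tensor y hy hq₁ b)).continuous.comp (continuous_tensor x hp₁ hx))
    (K.mem_closure_comp_right ha) ?_)
  rintro _ ⟨u, hu, rfl⟩
  exact h2 u hu

/-- Diagonal hom-spaces of a well-aligned ideal depend on the principal ideal only: tensoring with
an invertible element preserves them. -/
lemma WellAligned.tensor_mem (hK : K.WellAligned) {p r x : P} (hx : p * x = r)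
    (hr : principalRightIdeal p = principalRightIdeal r) {a : L p p} (ha : a ∈ K.hom p p) :
    tensor x hx hx a ∈ K.hom r r := by
  refine (K.isClosed_hom r r).closure_subset (map_mem_closure (continuous_tensor x hx hx)
    (K.mem_closure_comp_right ha) ?_)
  rintro _ ⟨u, hu, rfl⟩
  rw [SetLike.mem_coe, tensor_comp x hx hx hx]
  exact hK.comp_tensor_mem hx hx hx hx (by rw [Set.inter_self, hr]) ha hu

lemma exists_lcm (hP : IsRightLCM P) {p q w : P} (hp : w ∈ principalRightIdeal p)
    (hq : w ∈ principalRightIdeal q) : ∃ r x y g, p * x = r ∧ q * y = r ∧ r * g = w ∧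
      principalRightIdeal p ∩ principalRightIdeal q = principalRightIdeal r := by
  rcases hP p q with h | ⟨r, h⟩
  · exact absurd (h ▸ ⟨hp, hq⟩ : w ∈ (∅ : Set P)) (Set.notMem_empty w)
  · have hr : r ∈ principalRightIdeal p ∩ principalRightIdeal q := h ▸ ⟨1, (mul_one r).symm⟩
    have hw : w ∈ principalRightIdeal r := h ▸ ⟨hp, hq⟩
    obtain ⟨⟨x, hx⟩, ⟨y, hy⟩⟩ := hr
    obtain ⟨g, hg⟩ := hw
    exact ⟨r, x, y, g, hx.symm, hy.symm, hg.symm, h⟩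

/-- The spanning set of the diagonal hom-space at `w` of the right-tensor C*-precategory generated
by an ideal. -/
def generators (K : HomIdeal L) (w : P) : Set (Diag L w) :=
  {b | ∃ (s t r : P) (hs : s * r = w) (ht : t * r = w), ∃ a ∈ K.hom s t, b = tensor r hs ht a}

lemma WellAligned.generators_mul [IsLeftCancelMul P] (hK : K.WellAligned) (hP : IsRightLCM P)
    {w : P} {x y : Diag L w} (hx : x ∈ K.generators w) (hy : y ∈ K.generators w) :
    x * y ∈ K.generators w := by
  obtain ⟨s, t, r, hs, ht, a, ha, rfl⟩ := hx
  obtain ⟨s', t', r', hs', ht', b, hb, rfl⟩ := hy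
  obtain ⟨z, c, d, g, hc, hd, hg, hz⟩ := exists_lcm hP ⟨r, ht.symm⟩ ⟨r', hs'.symm⟩
  obtain rfl : r = c * g := mul_left_cancel (a := t) (by rw [ht, ← mul_assoc, hc, hg])
  obtain rfl : r' = d * g := mul_left_cancel (a := s') (by rw [hs', ← mul_assoc, hd, hg])
  refine ⟨s * c, t' * d, g, by rw [mul_assoc, hs], by rw [mul_assoc, ht'],
    comp (tensor c rfl hc a) (tensor d hd rfl b), hK.comp_tensor_mem hc hd rfl rfl hz ha hb, ?_⟩
  rw [tensor_comp g (q' := w) _ hg, tensor_tensor, tensor_tensor]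
  rfl

/-- The C*-algebra `L_K w w` of the right-tensor C*-precategory generated by a well-aligned
ideal. -/
noncomputable def WellAligned.diagGenerated [IsLeftCancelMul P] (hK : K.WellAligned)
    (hP : IsRightLCM P) (w : P) : NonUnitalStarSubalgebra ℂ (Diag L w) :=
  (spanStarSubalgebra (K.generators w)
    (fun _ hx _ hy => Submodule.subset_span (hK.generators_mul hP hx hy))
    (fun _ ⟨s, t, r, hs, ht, a, ha, h⟩ => ⟨t, s, r, ht, hs, adj a, K.adj_mem ha, by
      rw [h, tensor_adj]; rfl⟩)).topologicalClosure

end HomIdeal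

end Tensor

/-! ### Vectors and operators on the Fock module -/

section Fock

variable {Ob : Type u} {L : Ob → Ob → Type v}
    [∀ σ ρ, NormedAddCommGroup (L σ ρ)] [∀ σ ρ, NormedSpace ℂ (L σ ρ)]
    [∀ σ ρ, CompleteSpace (L σ ρ)] [CStarPrecategory L] {K : HomIdeal L}

namespace FockColumn

lemma norm_le_of_inner_le {t : Ob} {x y : FockColumn K t} {C : ℝ} (hC : 0 ≤ C)
    (h : inner x x ≤ (C ^ 2) • inner y y) : ‖x‖ ≤ C * ‖y‖ := by
  refine (sq_le_sq₀ (norm_nonneg _) (mul_nonneg hC (norm_nonneg _))).1 ?_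
  have h1 := CStarAlgebra.norm_le_norm_of_nonneg_of_le (inner_self_nonneg x) h
  rw [norm_smul, ← norm_sq, ← norm_sq, Real.norm_of_nonneg (by positivity)] at h1
  rw [mul_pow]
  exact h1

lemma norm_le_of_ip_le {t : Ob} {x y : FockColumn K t} {C : ℝ} (hC : 0 ≤ C)
    (h : ∀ s, ip (x s) (x s) ≤ (C ^ 2) • ip (y s) (y s)) : ‖x‖ ≤ C * ‖y‖ :=
  norm_le_of_inner_le hC
    (((x.summable x).tsum_le_tsum h ((y.summable y).const_smul (C ^ 2))).trans
      (le_of_eq (Summable.tsum_const_smul (C ^ 2) (y.summable y))))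

open Classical in
/-- The vector of `⨁ₛ K s t` with the single component `k` in `K w t`. -/
noncomputable def single {w t : Ob} (k : L w t) (hk : k ∈ K.hom w t) : FockColumn K t :=
  ⟨Pi.single w k, fun s => by
      by_cases hs : s = w
      · subst hs; rwa [Pi.single_eq_same]
      · rw [Pi.single_eq_of_ne hs]; exact zero_mem _,
    (hasSum_single w fun s hs => by rw [Pi.single_eq_of_ne hs, ip_zero_left]).summable⟩

lemma single_apply {w t : Ob} (k : L w t) (hk : k ∈ K.hom w t) : single k hk w = k := by
  classical
  exact Pi.single_eq_same (M := fun s => L s t) w k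

lemma single_apply_of_ne {w t s : Ob} (k : L w t) (hk : k ∈ K.hom w t) (hs : s ≠ w) :
    single k hk s = 0 := by
  classical
  exact Pi.single_eq_of_ne hs _

lemma norm_single {w t : Ob} (k : L w t) (hk : k ∈ K.hom w t) : ‖single k hk‖ = ‖k‖ := by
  refine (sq_eq_sq₀ (norm_nonneg _) (norm_nonneg _)).1 ?_
  rw [norm_sq, ← norm_ip_self k]
  refine congrArg norm ((tsum_eq_single w fun s hs => ?_).trans ?_)
  · rw [single_apply_of_ne k hk hs, ip_zero_left]
  · rw [single_apply]

end FockColumn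

namespace Fock

lemma norm_apply_le (x : Fock K) (t s : Ob) : ‖x.col t s‖ ≤ ‖x‖ :=
  ((x.col t).norm_apply_le s).trans (norm_col_le x t)

open Classical in
/-- The vector of the Fock module with the single component `k` in `K w t`. -/
noncomputable def single {w t : Ob} (k : L w t) (hk : k ∈ K.hom w t) : Fock K :=
  ⟨lp.single ∞ t (FockColumn.single k hk), tendsto_const_nhds.congr' (by
    filter_upwards [(Set.finite_singleton t).compl_mem_cofinite] with s hs
    have h := lp.single_apply_ne (E := FockColumn K) ∞ t (FockColumn.single k hk) hs
    exact (norm_zero.symm.trans (congrArg norm h).symm))⟩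

lemma single_apply {w t : Ob} (k : L w t) (hk : k ∈ K.hom w t) : (single k hk).col t w = k := by
  classical
  have h : (single k hk).col t = FockColumn.single k hk :=
    lp.single_apply_self (E := FockColumn K) ∞ t _
  rw [h, FockColumn.single_apply]

lemma norm_single_le {w t : Ob} (k : L w t) (hk : k ∈ K.hom w t) : ‖single k hk‖ ≤ ‖k‖ := by
  classical
  exact ((lp.norm_single (E := FockColumn K) ENNReal.zero_lt_top t _).trans
    (FockColumn.norm_single k hk)).le

/-- The inclusion of the Fock module of an ideal into that of the ambient precategory. -/
def incl (x : Fock K) : Fock (⊤ : HomIdeal L) :=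
  ⟨⟨fun t => ⟨fun s => x.col t s, fun _ => trivial, (x.col t).summable (x.col t)⟩, x.1.2⟩, x.2⟩

lemma norm_incl (x : Fock K) : ‖incl x‖ = ‖x‖ :=
  le_antisymm (norm_le (norm_nonneg _) fun t => norm_col_le x t)
    (norm_le (norm_nonneg _) fun t => norm_col_le (incl x) t)

end Fock

namespace FockOp

lemma ext {X Y : FockOp K} (h : ∀ x t w, (X.1 x).col t w = (Y.1 x).col t w) : X = Y :=
  Subtype.ext (ContinuousLinearMap.ext fun x => Fock.ext (h x))

@[simp] lemma add_apply (X Y : FockOp K) (x : Fock K) : (X + Y).1 x = X.1 x + Y.1 x := rfl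
@[simp] lemma smul_apply (c : ℂ) (X : FockOp K) (x : Fock K) : (c • X).1 x = c • X.1 x := rfl
@[simp] lemma mul_apply (X Y : FockOp K) (x : Fock K) : (X * Y).1 x = X.1 (Y.1 x) := rfl

lemma norm_apply_le (X : FockOp K) (x : Fock K) : ‖X.1 x‖ ≤ ‖X‖ * ‖x‖ := X.1.le_opNorm x

lemma norm_le {X : FockOp K} {C : ℝ} (hC : 0 ≤ C) (h : ∀ x, ‖X.1 x‖ ≤ C * ‖x‖) : ‖X‖ ≤ C :=
  X.1.opNorm_le_bound hC h

/-- `X` leaves the Fock module of the ideal invariant and restricts to `Y` there. -/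
def Extends (X : FockOp (⊤ : HomIdeal L)) (Y : FockOp K) : Prop :=
  ∀ x : Fock K, X.1 (Fock.incl x) = Fock.incl (Y.1 x)

namespace Extends

variable {X X' : FockOp (⊤ : HomIdeal L)} {Y Y' : FockOp K}

lemma norm_le (h : Extends X Y) : ‖Y‖ ≤ ‖X‖ :=
  FockOp.norm_le (norm_nonneg _) fun x => by
    rw [← Fock.norm_incl, ← h x, ← Fock.norm_incl x]
    exact X.norm_apply_le _

lemma zero : Extends (0 : FockOp (⊤ : HomIdeal L)) (0 : FockOp K) := fun _ => rfl

lemma add (h : Extends X Y) (h' : Extends X' Y') : Extends (X + X') (Y + Y') := fun x => by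
  rw [add_apply, h, h']; rfl

lemma smul (c : ℂ) (h : Extends X Y) : Extends (c • X) (c • Y) := fun x => by
  rw [smul_apply, h]; rfl

end Extends

lemma norm_snd_le_of_mem_span {S : Set (FockOp (⊤ : HomIdeal L) × FockOp K)}
    (hS : ∀ z ∈ S, Extends z.1 z.2) : ∀ z ∈ Submodule.span ℂ S, ‖z.2‖ ≤ ‖z.1‖ := by
  intro z hz
  suffices h : Extends z.1 z.2 from h.norm_le
  induction hz using Submodule.span_induction with
  | mem x hx => exact hS x hx
  | zero => exact Extends.zero
  | add x y _ _ h h' => exact h.add h'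
  | smul c x _ h => exact h.smul c

end FockOp

/-- Row `w` of the operator `X` is left multiplication by `c`. -/
def IsRowMul (X : FockOp K) (w : Ob) (c : Diag L w) : Prop :=
  ∀ (x : Fock K) (t : Ob), (X.1 x).col t w = lact c (x.col t w)

namespace IsRowMul

variable {X Y : FockOp K} {w : Ob} {c d : Diag L w}

lemma zero : IsRowMul (0 : FockOp K) w 0 := fun _ _ => (zero_comp (L := L) _).symm

lemma add (h : IsRowMul X w c) (h' : IsRowMul Y w d) : IsRowMul (X + Y) w (c + d) := fun x t => by
  rw [add_lact, ← h, ← h']; rfl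

lemma smul (z : ℂ) (h : IsRowMul X w c) : IsRowMul (z • X) w (z • c) := fun x t => by
  rw [smul_lact, ← h]; rfl

lemma mul (h : IsRowMul X w c) (h' : IsRowMul Y w d) : IsRowMul (X * Y) w (c * d) := fun x t => by
  rw [mul_lact, ← h', ← h]; rfl

lemma lact_eq (h : IsRowMul X w c) {t : Ob} {k : L w t} (hk : k ∈ K.hom w t) :
    lact c k = (X.1 (Fock.single k hk)).col t w := by
  rw [h, Fock.single_apply]

end IsRowMul

/-- The norm of a diagonal operator is at most the supremum of the norms of its rows. -/
lemma norm_le_of_isRowMul {X : FockOp K} {M : ℝ} (hM : 0 ≤ M)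
    (h : ∀ w, ∃ c : Diag L w, IsRowMul X w c ∧ ‖c‖ ≤ M) : ‖X‖ ≤ M :=
  FockOp.norm_le hM fun x => Fock.norm_le (mul_nonneg hM (norm_nonneg _)) fun t => by
    refine (FockColumn.norm_le_of_ip_le (y := x.col t) hM fun w => ?_).trans
      (mul_le_mul_of_nonneg_left (Fock.norm_col_le x t) hM)
    obtain ⟨c, hc, hcM⟩ := h w
    rw [hc x t]
    exact ip_comp_self_le (L := L) c (x.col t w) hcM

end Fock

/-! ### The conditional expectation -/

section Expectation

variable {Ob : Type u} {L : Ob → Ob → Type v}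
    [∀ σ ρ, NormedAddCommGroup (L σ ρ)] [∀ σ ρ, NormedSpace ℂ (L σ ρ)]
    [∀ σ ρ, CompleteSpace (L σ ρ)] [CStarPrecategory L] {K : HomIdeal L}

lemma rangeProj_apply_self (w t : Ob) (x : Fock K) : (rangeProj K w x).col t w = x.col t w :=
  if_pos rfl

lemma rangeProj_apply_of_ne {w s : Ob} (h : s ≠ w) (t : Ob) (x : Fock K) :
    (rangeProj K w x).col t s = 0 := if_neg h

lemma rangeProj_rangeProj_of_ne {w s : Ob} (h : s ≠ w) (x : Fock K) :
    rangeProj K s (rangeProj K w x) = 0 := by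
  refine Fock.ext fun t r => ?_
  by_cases hr : r = s
  · subst hr
    rw [rangeProj_apply_self, rangeProj_apply_of_ne h]; rfl
  · rw [rangeProj_apply_of_ne hr]; rfl

lemma expectation_apply (S : FockOp K) (x : Fock K) (t w : Ob) :
    ((expectation S).1 x).col t w = (S.1 (rangeProj K w x)).col t w := rfl

/-- The conditional expectation as a contractive linear map. -/
noncomputable def expectationCLM (K : HomIdeal L) : FockOp K →L[ℂ] FockOp K :=
  LinearMap.mkContinuous
    { toFun := expectation
      map_add' := fun _ _ => FockOp.ext fun _ _ _ => rfl
      map_smul' := fun _ _ => FockOp.ext fun _ _ _ => rfl } 1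
    fun S => by
      rw [one_mul]
      exact FockOp.norm_le (norm_nonneg S) fun x => Fock.norm_le (by positivity) fun t =>
        (FockColumn.norm_le_of_ip_le (y := x.col t) (norm_nonneg S) (diagPart_le S x t)).trans
          (mul_le_mul_of_nonneg_left (Fock.norm_col_le x t) (norm_nonneg S))

@[simp] lemma expectationCLM_apply (S : FockOp K) : expectationCLM K S = expectation S := rfl

lemma star_expectation (S : FockOp K) : star (expectation S) = expectation (star S) :=
  FockOp.star_eq fun x y t => tsum_congr fun w => by
    have h := FockOp.isAdjointPair_star S (rangeProj K w x) (rangeProj K w y) t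
    rw [inner_rangeProj_left, inner_rangeProj_right] at h
    exact h

/-- Operators fixed by the conditional expectation commute with the projections `Q_w`. -/
lemma apply_rangeProj_of_expectation_eq {D : FockOp K} (hD : expectation D = D) (w : Ob)
    (x : Fock K) : D.1 (rangeProj K w x) = rangeProj K w (D.1 x) := by
  refine Fock.ext fun t s => ?_
  by_cases hs : s = w
  · subst hs
    rw [rangeProj_apply_self, ← expectation_apply, hD]
  · rw [rangeProj_apply_of_ne hs, ← hD, expectation_apply, rangeProj_rangeProj_of_ne hs, map_zero]
    rfl

lemma expectation_mul_of_eq {D : FockOp K} (hD : expectation D = D) (A : FockOp K) :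
    expectation (A * D) = expectation A * D :=
  FockOp.ext fun x t w => by
    rw [expectation_apply, FockOp.mul_apply, apply_rangeProj_of_expectation_eq hD]; rfl

lemma expectation_mul_of_eq_left {D : FockOp K} (hD : expectation D = D) (A : FockOp K) :
    expectation (D * A) = D * expectation A := by
  apply star_injective
  have hD' : expectation (star D) = star D := by rw [← star_expectation, hD]
  rw [star_expectation, star_mul, expectation_mul_of_eq hD', star_mul, star_expectation]

lemma expectation_eq_of_isRowMul {X : FockOp K} (h : ∀ w, ∃ c, IsRowMul X w c) :
    expectation X = X :=
  FockOp.ext fun x t w => by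
    obtain ⟨c, hc⟩ := h w
    rw [expectation_apply, hc, hc, rangeProj_apply_self]

/-- The conditional expectations on both components of a pair. -/
noncomputable def pairExpectation (K : HomIdeal L) :
    FockOp (⊤ : HomIdeal L) × FockOp K →L[ℂ] FockOp (⊤ : HomIdeal L) × FockOp K :=
  (expectationCLM ⊤).prodMap (expectationCLM K)

lemma pairExpectation_apply (z : FockOp (⊤ : HomIdeal L) × FockOp K) :
    pairExpectation K z = (expectation z.1, expectation z.2) := rfl

/-- The conditional expectation is faithful. -/
lemma eq_zero_of_expectation_star_mul_self {X : FockOp K} (h : expectation (star X * X) = 0) :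
    X = 0 := by
  have h1 : ∀ (w : Ob) (x : Fock K), X.1 (rangeProj K w x) = 0 := fun w x => by
    refine Fock.ext fun t s => ?_
    have h2 := FockOp.isAdjointPair_star X (rangeProj K w x) (X.1 (rangeProj K w x)) t
    have h3 : ((star X).1 (X.1 (rangeProj K w x))).col t w = 0 := by
      rw [← FockOp.mul_apply, ← expectation_apply, h]; rfl
    rw [inner_rangeProj_left, h3, ip_zero_right, FockColumn.inner_self_eq_zero] at h2
    rw [h2]; rfl
  have h4 : star X = 0 := FockOp.ext fun y t w => by
    have h2 := FockOp.isAdjointPair_star X (rangeProj K w ((star X).1 y)) y t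
    rw [h1, inner_rangeProj_left] at h2
    have h5 := norm_ip_self (((star X).1 y).col t w)
    rw [← h2] at h5
    have h6 : FockColumn.inner ((0 : Fock K).col t) (y.col t) = 0 := by
      simp [FockColumn.inner]
    rw [h6, norm_zero] at h5
    exact norm_eq_zero.1 ((pow_eq_zero_iff two_ne_zero).1 h5.symm)
  exact star_eq_zero.1 h4

end Expectation

/-! ### The Fock representation -/

section FockRep

variable {P : Type u} [Monoid P] [IsLeftCancelMul P] {L : P → P → Type v}
    [∀ p q, NormedAddCommGroup (L p q)] [∀ p q, NormedSpace ℂ (L p q)]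
    [∀ p q, CompleteSpace (L p q)] [CStarPrecategory L] [RightTensoring L]

lemma fockFun_eq (R : Set P) {p q : P} (a : L p q) {t : P} (x : ∀ s, L s t) {r w v : P}
    (hr : r ∈ R) (hp : p * r = w) (hq : q * r = v) :
    fockFun R a x w = comp (tensor r hp hq a) (x v) := by
  subst hp hq
  exact fockFun_mul R a x hr

variable {K : HomIdeal L}

lemma fockOp_apply (R : Set P) {p q : P} (a : L p q) (x : Fock K) (t w : P) :
    ((fockOp K R a).1 x).col t w = fockFun R a (x.col t) w := rfl

lemma star_fockOp (R : Set P) {p q : P} (a : L p q) :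
    star (fockOp K R a) = fockOp K R (adj a) :=
  FockOp.star_eq fun x y t => fockFun_adjoint R a (x.col t) (y.col t)

lemma star_fockRep {p q : P} (a : L p q) : star (fockRep K a) = fockRep K (adj a) :=
  star_fockOp _ a

lemma norm_fockOp_le (R : Set P) {p q : P} (a : L p q) : ‖fockOp K R a‖ ≤ ‖a‖ :=
  FockOp.norm_le (norm_nonneg a) fun x => Fock.norm_le (by positivity) fun t =>
    (FockColumn.norm_le_of_inner_le (x := ((fockOp K R a).1 x).col t) (norm_nonneg a)
      (fockFun_summable R a (x.col t)).2).trans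
        (mul_le_mul_of_nonneg_left (Fock.norm_col_le x t) (norm_nonneg a))

/-- The map `a ↦ fockOp K R a` as a linear map. -/
noncomputable def fockOpₗ (K : HomIdeal L) (R : Set P) (p q : P) : L p q →ₗ[ℂ] FockOp K where
  toFun := fockOp K R
  map_add' a b := FockOp.ext fun x t w => by
    rw [FockOp.add_apply, Fock.col_add, FockColumn.add_apply]
    simp only [fockOp_apply]
    by_cases h : ∃ r ∈ R, p * r = w
    · obtain ⟨r, hr, h⟩ := h
      rw [fockFun_eq R _ _ hr h rfl, fockFun_eq R _ _ hr h rfl, fockFun_eq R _ _ hr h rfl, map_add,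
        add_comp]
    · rw [fockFun_of_notMem R _ _ h, fockFun_of_notMem R _ _ h, fockFun_of_notMem R _ _ h,
        add_zero]
  map_smul' c a := FockOp.ext fun x t w => by
    rw [RingHom.id_apply, FockOp.smul_apply, Fock.col_smul, FockColumn.smul_apply]
    simp only [fockOp_apply]
    by_cases h : ∃ r ∈ R, p * r = w
    · obtain ⟨r, hr, h⟩ := h
      rw [fockFun_eq R _ _ hr h rfl, fockFun_eq R _ _ hr h rfl, map_smul, smul_comp]
    · rw [fockFun_of_notMem R _ _ h, fockFun_of_notMem R _ _ h, smul_zero]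

lemma extends_fockOp (R : Set P) {p q : P} (a : L p q) :
    (fockOp (⊤ : HomIdeal L) R a).Extends (fockOp K R a) := fun _ => Fock.ext fun _ _ => rfl

/-- The Fock representation is Nica covariant. -/
lemma fockRep_mul {p q p' q' z c d p₁ q₁ : P} (hc : q * c = z) (hd : p' * d = z)
    (hp₁ : p * c = p₁) (hq₁ : q' * d = q₁)
    (hz : principalRightIdeal q ∩ principalRightIdeal p' = principalRightIdeal z)
    (a : L p q) (b : L p' q') :
    fockRep K a * fockRep K b
      = fockRep K (comp (tensor c hp₁ hc a) (tensor d hd hq₁ b)) := by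
  refine FockOp.ext fun x t w => ?_
  change fockFun Set.univ a ((fockRep K b).1 x |>.col t) w = fockFun Set.univ _ (x.col t) w
  by_cases hw : ∃ g, p₁ * g = w
  · obtain ⟨g, hg⟩ := hw
    have h1 : p * (c * g) = w := by rw [← mul_assoc, hp₁, hg]
    have h2 : q * (c * g) = z * g := by rw [← mul_assoc, hc]
    have h3 : p' * (d * g) = z * g := by rw [← mul_assoc, hd]
    have h4 : q' * (d * g) = q₁ * g := by rw [← mul_assoc, hq₁]
    rw [fockFun_eq _ a _ (Set.mem_univ (c * g)) h1 h2, fockFun_eq _ _ _ (Set.mem_univ g) hg rfl]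
    change comp _ (fockFun Set.univ b (x.col t) (z * g)) = _
    rw [fockFun_eq _ b _ (Set.mem_univ (d * g)) h3 h4, ← comp_assoc,
      tensor_comp g hg (rfl : z * g = z * g) rfl, tensor_tensor, tensor_tensor]
  · refine Eq.trans ?_ (fockFun_of_notMem _ _ _ (by simpa using hw)).symm
    by_cases hr : ∃ r, p * r = w
    · obtain ⟨r, hr⟩ := hr
      rw [fockFun_eq _ a _ (Set.mem_univ r) hr rfl]
      change comp _ (fockFun Set.univ b (x.col t) (q * r)) = _
      rw [fockFun_of_notMem, comp_zero]
      rintro ⟨s, -, hs⟩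
      have : q * r ∈ principalRightIdeal z := hz ▸ ⟨⟨r, rfl⟩, ⟨s, hs.symm⟩⟩
      obtain ⟨g, hg⟩ := this
      obtain rfl : r = c * g := mul_left_cancel (a := q) (by rw [hg, ← mul_assoc, hc])
      exact hw ⟨g, by rw [← hr, ← mul_assoc, hp₁]⟩
    · exact fockFun_of_notMem _ _ _ (by simpa using hr)

lemma fockRep_mul_of_disjoint {p q p' q' : P}
    (h : principalRightIdeal q ∩ principalRightIdeal p' = ∅) (a : L p q) (b : L p' q') :
    fockRep K a * fockRep K b = 0 := by
  refine FockOp.ext fun x t w => ?_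
  change fockFun Set.univ a ((fockRep K b).1 x |>.col t) w = 0
  by_cases hr : ∃ r, p * r = w
  · obtain ⟨r, hr⟩ := hr
    rw [fockFun_eq _ a _ (Set.mem_univ r) hr rfl]
    change comp _ (fockFun Set.univ b (x.col t) (q * r)) = _
    rw [fockFun_of_notMem, comp_zero]
    rintro ⟨s, -, hs⟩
    exact Set.notMem_empty (q * r) (h ▸ ⟨⟨r, rfl⟩, ⟨s, hs.symm⟩⟩)
  · rw [fockFun_of_notMem _ _ _ (by simpa using hr)]

/-- Tensoring with an invertible element does not change the Fock representation. -/
lemma fockRep_tensor {p r x : P} (hx : p * x = r)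
    (hr : principalRightIdeal p = principalRightIdeal r) (a : L p p) :
    fockRep K (tensor x hx hx a) = fockRep K a := by
  refine FockOp.ext fun y t w => ?_
  change fockFun Set.univ _ (y.col t) w = fockFun Set.univ _ (y.col t) w
  by_cases hw : ∃ g, r * g = w
  · obtain ⟨g, hg⟩ := hw
    have h1 : p * (x * g) = w := by rw [← mul_assoc, hx, hg]
    rw [fockFun_eq _ _ _ (Set.mem_univ g) hg hg, fockFun_eq _ _ _ (Set.mem_univ (x * g)) h1 h1,
      tensor_tensor]
  · rw [fockFun_of_notMem _ _ _ (by simpa using hw), fockFun_of_notMem]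
    rintro ⟨s, -, hs⟩
    have : w ∈ principalRightIdeal r := hr ▸ ⟨s, hs.symm⟩
    obtain ⟨g, hg⟩ := this
    exact hw ⟨g, hg.symm⟩

lemma isRowMul_fockOp (R : Set P) {p q : P} (a : L p q) {r w : P} (hr : r ∈ R) (hp : p * r = w)
    (hq : q * r = w) : IsRowMul (fockOp K R a) w (tensor (L := L) r hp hq a) := fun x t =>
  fockFun_eq R a (x.col t) hr hp hq

lemma isRowMul_fockOp_zero (R : Set P) {p q : P} (a : L p q) {w : P}
    (hw : ¬ ∃ r ∈ R, p * r = w) : IsRowMul (fockOp K R a) w 0 := fun x t =>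
  (fockFun_of_notMem R a (x.col t) hw).trans (zero_comp (L := L) _).symm

/-- The rows of `T_Δ(a)` are left multiplications by elements of the C*-algebras `L_K w w`, the same
for the Fock modules of all ideals. -/
lemma exists_isRowMul_fockDiag (K : HomIdeal L) {p q : P} {a : L p q} (ha : a ∈ K.hom p q)
    (w : P) : ∃ c : Diag L w, (c : L w w) ∈ K.generated w w ∧
      ∀ K' : HomIdeal L, IsRowMul (fockDiag K' a) w c ∧
        IsRowMul (star (fockDiag K' a)) w (star c) := by
  by_cases hw : ∃ r, p * r = w ∧ q * r = w
  · obtain ⟨r, hp, hq⟩ := hw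
    have hr : r ∈ {r | p * r = q * r} := hp.trans hq.symm
    have e : star (show Diag L w from tensor r hp hq a) = tensor (L := L) r hq hp (adj a) :=
      (tensor_adj r hp hq a).symm
    have hmem : tensor r hp hq a ∈ K.generated w w := Submodule.le_topologicalClosure _
      (Submodule.subset_span ⟨p, q, r, hp, hq, a, ha, rfl⟩)
    refine ⟨tensor (L := L) r hp hq a, hmem, fun K' => ⟨isRowMul_fockOp _ a hr hp hq, ?_⟩⟩
    rw [e, fockDiag, star_fockOp]
    exact isRowMul_fockOp _ (adj a) hr hq hp
  · refine ⟨(0 : L w w), (K.generated w w).zero_mem, fun K' =>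
      ⟨isRowMul_fockOp_zero _ a ?_, ?_⟩⟩
    · rintro ⟨r, hr, hp⟩
      exact hw ⟨r, hp, (show p * r = q * r from hr) ▸ hp⟩
    · change IsRowMul _ w (star (0 : Diag L w))
      rw [star_zero, fockDiag, star_fockOp]
      refine isRowMul_fockOp_zero _ _ ?_
      rintro ⟨r, hr, hp⟩
      exact hw ⟨r, (show p * r = q * r from hr).trans hp, hp⟩

lemma expectation_fockDiag {p q : P} (a : L p q) :
    expectation (fockDiag K a) = fockDiag K a :=
  expectation_eq_of_isRowMul fun w =>
    let ⟨c, _, hc⟩ := exists_isRowMul_fockDiag ⊤ (a := a) trivial w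
    ⟨c, (hc K).1⟩

/-- Only the components of `T(a)` from row `w` to itself survive under the conditional
expectation. -/
lemma expectation_fockRep {p q : P} (a : L p q) : expectation (fockRep K a) = fockDiag K a := by
  refine FockOp.ext fun x t w => ?_
  rw [expectation_apply]
  change fockFun Set.univ a ((rangeProj K w x).col t) w = fockFun _ a (x.col t) w
  by_cases hw : ∃ r, p * r = w
  · obtain ⟨r, hr⟩ := hw
    by_cases hq : q * r = w
    · rw [fockFun_eq _ a _ (Set.mem_univ r) hr hq,
        fockFun_eq {r | p * r = q * r} a _ (hr.trans hq.symm) hr hq, rangeProj_apply_self]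
    · rw [fockFun_eq _ a _ (Set.mem_univ r) hr rfl, rangeProj_apply_of_ne hq, comp_zero,
        fockFun_of_notMem]
      rintro ⟨s, hs, hs'⟩
      obtain rfl : s = r := mul_left_cancel (a := p) (hs'.trans hr.symm)
      exact hq ((show p * s = q * s from hs) ▸ hr)
  · rw [fockFun_of_notMem _ _ _ (by simpa using hw), fockFun_of_notMem]
    rintro ⟨s, -, hs⟩
    exact hw ⟨s, hs⟩

/-- If `P` is cancellative, then `p r = q r` only for `p = q`. -/
lemma fockDiag_of_ne [IsRightCancelMul P] {p q : P} (h : p ≠ q) (a : L p q) :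
    fockDiag K a = 0 := by
  refine FockOp.ext fun x t w => fockFun_of_notMem _ a (x.col t) ?_
  rintro ⟨r, hr, -⟩
  exact h (mul_right_cancel (show p * r = q * r from hr))

lemma fockDiag_self {p : P} (a : L p p) : fockDiag K a = fockRep K a := by
  have : {r : P | p * r = p * r} = Set.univ := Set.eq_univ_of_forall fun _ => rfl
  rw [fockDiag, this, fockRep]

lemma fockOp_singleton_mul {p : P} (a b : L p p) :
    fockOp K {1} (comp a b) = fockOp K {1} a * fockOp K {1} b := by
  refine FockOp.ext fun x t s => ?_
  change fockFun {1} _ (x.col t) s = fockFun {1} a ((fockOp K {1} b).1 x |>.col t) s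
  by_cases hs : s = p
  · subst hs
    rw [fockFun_eq _ _ _ (Set.mem_singleton _) (mul_one s) (mul_one s),
      fockFun_eq _ _ _ (Set.mem_singleton _) (mul_one s) (mul_one s), fockOp_apply,
      fockFun_eq _ _ _ (Set.mem_singleton _) (mul_one s) (mul_one s),
      tensor_one, tensor_one, tensor_one, comp_assoc]
  · have h : ¬ ∃ r ∈ ({1} : Set P), p * r = s := by
      rintro ⟨r, rfl, h⟩
      exact hs (h.symm.trans (mul_one p))
    rw [fockFun_of_notMem _ _ _ h, fockFun_of_notMem _ _ _ h]

/-- The action of `L w w` by left multiplication on row `w` of the Fock module. -/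
noncomputable def rowHom (K : HomIdeal L) (w : P) : Diag L w →⋆ₙₐ[ℂ] FockOp K where
  toFun c := fockOp K {1} (p := w) (q := w) c
  map_smul' c d := (fockOpₗ K {1} w w).map_smul c d
  map_zero' := (fockOpₗ K {1} w w).map_zero
  map_add' c d := (fockOpₗ K {1} w w).map_add c d
  map_star' c := (star_fockOp {1} (p := w) (q := w) c).symm
  map_mul' c d := fockOp_singleton_mul (p := w) c d

lemma isRowMul_rowHom (w : P) (c : Diag L w) : IsRowMul (rowHom K w c) w c := by
  have h := isRowMul_fockOp (K := K) {1} (p := w) (q := w) c rfl (mul_one w) (mul_one w)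
  have e : tensor (L := L) 1 (mul_one w) (mul_one w) c = c := tensor_one (L := L) c
  rw [e] at h
  exact h

lemma norm_rowHom_le {X : FockOp K} {w : P} {c : Diag L w} (h : IsRowMul X w c) :
    ‖rowHom K w c‖ ≤ ‖X‖ := by
  refine FockOp.norm_le (norm_nonneg X) fun x => ?_
  have e : (rowHom K w c).1 x = rangeProj K w (X.1 x) := by
    refine Fock.ext fun t s => ?_
    by_cases hs : s = w
    · subst hs
      rw [rangeProj_apply_self, h, isRowMul_rowHom]
    · rw [rangeProj_apply_of_ne hs]
      refine fockFun_of_notMem _ _ _ ?_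
      rintro ⟨r, rfl, h⟩
      exact hs (h.symm.trans (mul_one w))
  rw [e]
  refine le_trans ?_ (X.norm_apply_le x)
  refine Fock.norm_le (norm_nonneg _) fun t => ?_
  refine le_trans ?_ (Fock.norm_col_le (X.1 x) t)
  refine (FockColumn.norm_le_of_ip_le (y := (X.1 x).col t) zero_le_one fun s => ?_).trans_eq
    (one_mul _)
  rw [one_pow, one_smul]
  by_cases hs : s = w
  · subst hs
    rw [rangeProj_apply_self]
  · rw [rangeProj_apply_of_ne hs, ip_zero_left]
    exact ip_self_nonneg _

end FockRep

/-! ### Pairs of operators on the two Fock modules -/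

section Pair

variable {P : Type u} [Monoid P] [IsLeftCancelMul P] {L : P → P → Type v}
    [∀ p q, NormedAddCommGroup (L p q)] [∀ p q, NormedSpace ℂ (L p q)]
    [∀ p q, CompleteSpace (L p q)] [CStarPrecategory L] [RightTensoring L]

/-- The pair `(S(a), T(a))` of operators on the Fock modules of the precategory and of the ideal. -/
noncomputable def fockPair (K : HomIdeal L) {p q : P} (a : L p q) :
    FockOp (⊤ : HomIdeal L) × FockOp K := (fockRep ⊤ a, fockRep K a)

/-- The pair `(S_Δ(a), T_Δ(a))`. -/
noncomputable def diagPair (K : HomIdeal L) {p q : P} (a : L p q) :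
    FockOp (⊤ : HomIdeal L) × FockOp K := (fockDiag ⊤ a, fockDiag K a)

variable {K : HomIdeal L}

lemma star_fockPair {p q : P} (a : L p q) : star (fockPair K a) = fockPair K (adj a) :=
  Prod.ext (star_fockRep a) (star_fockRep a)

lemma fockPair_mul {p q p' q' z c d p₁ q₁ : P} (hc : q * c = z) (hd : p' * d = z)
    (hp₁ : p * c = p₁) (hq₁ : q' * d = q₁)
    (hz : principalRightIdeal q ∩ principalRightIdeal p' = principalRightIdeal z)
    (a : L p q) (b : L p' q') :
    fockPair K a * fockPair K b
      = fockPair K (comp (tensor c hp₁ hc a) (tensor d hd hq₁ b)) :=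
  Prod.ext (fockRep_mul hc hd hp₁ hq₁ hz a b) (fockRep_mul hc hd hp₁ hq₁ hz a b)

lemma fockPair_mul_of_disjoint {p q p' q' : P}
    (h : principalRightIdeal q ∩ principalRightIdeal p' = ∅) (a : L p q) (b : L p' q') :
    fockPair K a * fockPair K b = 0 :=
  Prod.ext (fockRep_mul_of_disjoint h a b) (fockRep_mul_of_disjoint h a b)

/-- The map `a ↦ (S(a), T(a))` as a linear map. -/
noncomputable def fockPairₗ (K : HomIdeal L) (p q : P) :
    L p q →ₗ[ℂ] FockOp (⊤ : HomIdeal L) × FockOp K :=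
  (fockOpₗ ⊤ Set.univ p q).prod (fockOpₗ K Set.univ p q)

/-- The *-algebra of all linear combinations of pairs `(S(a), T(a))` with `a` in the ideal. -/
noncomputable def HomIdeal.WellAligned.pairAlgebra (hK : K.WellAligned) (hP : IsRightLCM P) :
    NonUnitalStarSubalgebra ℂ (FockOp (⊤ : HomIdeal L) × FockOp K) :=
  spanStarSubalgebra {z | ∃ (p q : P) (a : L p q), a ∈ K.hom p q ∧ z = fockPair K a}
    (by
      rintro _ ⟨p, q, a, ha, rfl⟩ _ ⟨p', q', b, hb, rfl⟩
      rcases Set.eq_empty_or_nonempty (principalRightIdeal q ∩ principalRightIdeal p')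
        with h | ⟨w, hq, hp⟩
      · rw [fockPair_mul_of_disjoint h]
        exact zero_mem _
      · obtain ⟨z, c, d, -, hc, hd, -, hz⟩ := HomIdeal.exists_lcm hP hq hp
        exact Submodule.subset_span ⟨_, _, _, hK.comp_tensor_mem hc hd rfl rfl hz ha hb,
          fockPair_mul hc hd rfl rfl hz a b⟩)
    (by
      rintro _ ⟨p, q, a, ha, rfl⟩
      exact ⟨q, p, adj a, K.adj_mem ha, star_fockPair a⟩)

lemma HomIdeal.WellAligned.fockPair_mem (hK : K.WellAligned) (hP : IsRightLCM P) {p q : P}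
    {a : L p q} (ha : a ∈ K.hom p q) : fockPair K a ∈ hK.pairAlgebra hP :=
  Submodule.subset_span ⟨p, q, a, ha, rfl⟩

/-! ### Diagonal operators: essential ideals -/

/-- For an essential ideal, the C*-algebra `L_K w w` acts faithfully, hence isometrically, on
row `w` of the Fock module of the ideal. -/
lemma norm_le_norm_rowHom (hK : K.WellAligned) (hP : IsRightLCM P)
    (h : K.IsEssentialIn K.generated) {w : P} {c : Diag L w} (hc : c ∈ hK.diagGenerated hP w) :
    ‖c‖ ≤ ‖rowHom K w c‖ := by
  have hcl : IsClosed (hK.diagGenerated hP w : Set (Diag L w)) :=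
    NonUnitalStarSubalgebra.isClosed_topologicalClosure _
  let _ : NonUnitalCStarAlgebra (hK.diagGenerated hP w) :=
    NonUnitalStarSubalgebra.nonUnitalCStarAlgebra _ (h_closed := hcl)
  let φ : hK.diagGenerated hP w →⋆ₙₐ[ℂ] FockOp K :=
    (rowHom K w).comp (NonUnitalStarSubalgebraClass.subtype _)
  have hφ : Function.Injective φ := by
    rw [injective_iff_map_eq_zero]
    intro x hx
    refine Subtype.ext (h w x.1 x.2 fun k hk => ?_)
    have h1 := (isRowMul_rowHom (K := K) w x.1).lact_eq hk
    rw [show rowHom K w x.1 = 0 from hx] at h1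
    exact h1
  exact (NonUnitalStarAlgHom.norm_map φ hφ ⟨c, hc⟩).ge

/-- The *-algebra of pairs of diagonal operators whose common rows are left multiplications by
elements of the C*-algebras `L_K w w`. -/
noncomputable def HomIdeal.WellAligned.diagonalPairs (hK : K.WellAligned) (hP : IsRightLCM P) :
    NonUnitalStarSubalgebra ℂ (FockOp (⊤ : HomIdeal L) × FockOp K) where
  carrier := {z | ∀ w, ∃ c ∈ hK.diagGenerated hP w, IsRowMul z.1 w c ∧ IsRowMul z.2 w c ∧
    IsRowMul (star z.1) w (star c) ∧ IsRowMul (star z.2) w (star c)}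
  add_mem' {z z'} hz hz' w := by
    obtain ⟨c, hc, h1, h2, h3, h4⟩ := hz w
    obtain ⟨c', hc', h1', h2', h3', h4'⟩ := hz' w
    refine ⟨c + c', add_mem hc hc', h1.add h1', h2.add h2', ?_, ?_⟩
    · rw [Prod.fst_add, star_add, star_add]; exact h3.add h3'
    · rw [Prod.snd_add, star_add, star_add]; exact h4.add h4'
  zero_mem' w := by
    refine ⟨0, zero_mem _, .zero, .zero, ?_, ?_⟩
    · rw [Prod.fst_zero, star_zero, star_zero]; exact .zero
    · rw [Prod.snd_zero, star_zero, star_zero]; exact .zero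
  mul_mem' {z z'} hz hz' w := by
    obtain ⟨c, hc, h1, h2, h3, h4⟩ := hz w
    obtain ⟨c', hc', h1', h2', h3', h4'⟩ := hz' w
    refine ⟨c * c', mul_mem hc hc', h1.mul h1', h2.mul h2', ?_, ?_⟩
    · rw [Prod.fst_mul, star_mul, star_mul]; exact h3'.mul h3
    · rw [Prod.snd_mul, star_mul, star_mul]; exact h4'.mul h4
  smul_mem' r {z} hz w := by
    obtain ⟨c, hc, h1, h2, h3, h4⟩ := hz w
    refine ⟨r • c, SMulMemClass.smul_mem r hc, h1.smul r, h2.smul r, ?_, ?_⟩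
    · rw [Prod.smul_fst, star_smul, star_smul]; exact h3.smul _
    · rw [Prod.smul_snd, star_smul, star_smul]; exact h4.smul _
  star_mem' {z} hz w := by
    obtain ⟨c, hc, h1, h2, h3, h4⟩ := hz w
    refine ⟨star c, star_mem hc, h3, h4, ?_, ?_⟩
    · rw [Prod.fst_star, star_star, star_star]; exact h1
    · rw [Prod.snd_star, star_star, star_star]; exact h2

lemma norm_fst_le_of_mem_diagonalPairs (hK : K.WellAligned) (hP : IsRightLCM P)
    (h : K.IsEssentialIn K.generated) {z : FockOp (⊤ : HomIdeal L) × FockOp K}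
    (hz : z ∈ hK.diagonalPairs hP) : ‖z.1‖ ≤ ‖z.2‖ :=
  norm_le_of_isRowMul (norm_nonneg _) fun w => by
    obtain ⟨c, hc, h1, h2, -⟩ := hz w
    exact ⟨c, h1, (norm_le_norm_rowHom hK hP h hc).trans (norm_rowHom_le h2)⟩

lemma diagPair_mem_diagonalPairs (hK : K.WellAligned) (hP : IsRightLCM P) {p q : P} {a : L p q}
    (ha : a ∈ K.hom p q) : diagPair K a ∈ hK.diagonalPairs hP := by
  intro w
  obtain ⟨c, hc, h⟩ := exists_isRowMul_fockDiag K ha w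
  exact ⟨c, hc, (h ⊤).1, (h K).1, (h ⊤).2, (h K).2⟩

end Pair

/-! ### Diagonal operators: cancellative semigroups -/

section Cancellative

/-- A finite family of principal right ideals in a right LCM semigroup is contained in a finite
family that is closed under nonempty intersections. -/
lemma exists_finite_closed_inter {P : Type u} [Monoid P] (hP : IsRightLCM P)
    {G : Set (Set P)} (hG : G.Finite)
    (hprin : ∀ I ∈ G, ∃ p, principalRightIdeal p = I) :
    ∃ F : Set (Set P), F.Finite ∧ G ⊆ F ∧ (∀ I ∈ F, ∃ p, principalRightIdeal p = I) ∧
      ∀ I ∈ F, ∀ J ∈ F, (I ∩ J).Nonempty → I ∩ J ∈ F := by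
  refine ⟨{I | (∃ s ⊆ G, ⋂₀ s = I) ∧ ∃ p, principalRightIdeal p = I}, ?_, ?_, fun I hI => hI.2, ?_⟩
  · refine (hG.powerset.image fun s => ⋂₀ s).subset ?_
    rintro I ⟨⟨s, hs, hI⟩, -⟩
    exact ⟨s, hs, hI⟩
  · exact fun I hI => ⟨⟨{I}, Set.singleton_subset_iff.2 hI, Set.sInter_singleton I⟩, hprin I hI⟩
  · rintro _ ⟨⟨s, hs, rfl⟩, p, hp⟩ _ ⟨⟨t, ht, rfl⟩, q, hq⟩ hne
    refine ⟨⟨s ∪ t, Set.union_subset hs ht, Set.sInter_union s t⟩, ?_⟩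
    rw [← hp, ← hq] at hne ⊢
    rcases hP p q with h | ⟨r, h⟩
    · exact absurd h hne.ne_empty
    · exact ⟨r, h.symm⟩

variable {P : Type u} [Monoid P] [IsLeftCancelMul P] {L : P → P → Type v}
    [∀ p q, NormedAddCommGroup (L p q)] [∀ p q, NormedSpace ℂ (L p q)]
    [∀ p q, CompleteSpace (L p q)] [CStarPrecategory L] [RightTensoring L]

variable {K : HomIdeal L}

/-- The pairs `(S(a), T(a))` with `a ∈ K p p`, where the principal right ideal `pP` belongs to a
given family. -/
def idealPairs (K : HomIdeal L) (F : Set (Set P)) : Set (FockOp (⊤ : HomIdeal L) × FockOp K) :=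
  {z | ∃ (p : P) (a : L p p), a ∈ K.hom p p ∧ principalRightIdeal p ∈ F ∧ z = fockPair K a}

/-- The *-algebra spanned by the pairs of a family of principal right ideals that is closed under
nonempty intersections. -/
noncomputable def HomIdeal.WellAligned.idealAlgebra (hK : K.WellAligned) (hP : IsRightLCM P)
    (F : Set (Set P)) (hF : ∀ I ∈ F, ∀ J ∈ F, (I ∩ J).Nonempty → I ∩ J ∈ F) :
    NonUnitalStarSubalgebra ℂ (FockOp (⊤ : HomIdeal L) × FockOp K) :=
  spanStarSubalgebra (idealPairs K F)
    (by
      rintro _ ⟨p, a, ha, hp, rfl⟩ _ ⟨q, b, hb, hq, rfl⟩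
      rcases Set.eq_empty_or_nonempty (principalRightIdeal p ∩ principalRightIdeal q)
        with h | h
      · rw [fockPair_mul_of_disjoint h]
        exact zero_mem _
      · obtain ⟨w, hwp, hwq⟩ := h
        obtain ⟨z, c, d, -, hc, hd, -, hz⟩ := HomIdeal.exists_lcm hP hwp hwq
        exact Submodule.subset_span ⟨_, _, hK.comp_tensor_mem hc hd hc hd hz ha hb,
          hz ▸ hF _ hp _ hq ⟨w, hwp, hwq⟩, fockPair_mul hc hd hc hd hz a b⟩)
    (by
      rintro _ ⟨p, a, ha, hp, rfl⟩
      exact ⟨p, adj a, K.adj_mem ha, hp, star_fockPair a⟩)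

/-- A linear combination of pairs of a finite family of principal right ideals involves a single
pair for each ideal, with the coefficient at a chosen generator of the ideal. -/
lemma exists_eq_sum_of_mem_span (hK : K.WellAligned) {F : Set (Set P)} [Fintype F]
    {g : F → P} (hg : ∀ I, principalRightIdeal (g I) = I)
    {z : FockOp (⊤ : HomIdeal L) × FockOp K} (hz : z ∈ Submodule.span ℂ (idealPairs K F)) :
    ∃ a : ∀ I, L (g I) (g I), (∀ I, a I ∈ K.hom (g I) (g I)) ∧
      z = ∑ I, fockPair K (a I) := by
  classical
  induction hz using Submodule.span_induction with
  | mem x hx =>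
    obtain ⟨p, a, ha, hp, rfl⟩ := hx
    let I : F := ⟨principalRightIdeal p, hp⟩
    have hI : principalRightIdeal p = principalRightIdeal (g I) := (hg I).symm
    obtain ⟨x, hx⟩ : g I ∈ principalRightIdeal p := hI ▸ ⟨1, (mul_one _).symm⟩
    refine ⟨Pi.single I (tensor x hx.symm hx.symm a), fun J => ?_, ?_⟩
    · by_cases hJ : J = I
      · subst hJ
        rw [Pi.single_eq_same]
        exact hK.tensor_mem hx.symm hI ha
      · rw [Pi.single_eq_of_ne hJ]
        exact zero_mem _
    · rw [Finset.sum_eq_single I, Pi.single_eq_same]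
      · exact Prod.ext (fockRep_tensor hx.symm hI a).symm (fockRep_tensor hx.symm hI a).symm
      · intro J _ hJ
        rw [Pi.single_eq_of_ne hJ]
        exact (fockPairₗ K (g J) (g J)).map_zero
      · exact fun h => absurd (Finset.mem_univ I) h
  | zero =>
    exact ⟨0, fun I => zero_mem _, (Finset.sum_eq_zero fun I _ =>
      (fockPairₗ K (g I) (g I)).map_zero).symm⟩
  | add x y _ _ hx hy =>
    obtain ⟨a, ha, rfl⟩ := hx
    obtain ⟨b, hb, rfl⟩ := hy
    refine ⟨a + b, fun I => add_mem (ha I) (hb I), ?_⟩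
    rw [← Finset.sum_add_distrib]
    exact Finset.sum_congr rfl fun I _ => ((fockPairₗ K (g I) (g I)).map_add _ _).symm
  | smul c x _ hx =>
    obtain ⟨a, ha, rfl⟩ := hx
    refine ⟨c • a, fun I => Submodule.smul_mem _ c (ha I), ?_⟩
    rw [Finset.smul_sum]
    exact Finset.sum_congr rfl fun I _ => ((fockPairₗ K (g I) (g I)).map_smul _ _).symm

/-- The coefficients of a combination of operators `T(a_I)` are controlled by its norm: in the row
of the generator of `I` only the coefficients of `I` and of larger ideals occur, so that they can be
recovered one after another. -/
lemma exists_norm_coeff_le {F : Set (Set P)} [Fintype F] {g : F → P}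
    (hg : ∀ I, principalRightIdeal (g I) = I) (I : F) :
    ∃ C : ℝ, ∀ a : ∀ I, L (g I) (g I), (∀ I, a I ∈ K.hom (g I) (g I)) →
      ‖a I‖ ≤ C * ‖∑ J, fockRep K (a J)‖ := by
  classical
  induction I using WellFoundedGT.induction with
  | ind I ih =>
  choose! C hC using ih
  refine ⟨1 + ∑ J, |C J|, fun a ha => ?_⟩
  set Y := ∑ J, fockRep K (a J) with hY
  have hk : adj (a I) ∈ K.hom (g I) (g I) := K.adj_mem (ha I)
  set s := Fock.single (adj (a I)) hk with hs
  have hs1 : ‖s‖ ≤ ‖a I‖ := (Fock.norm_single_le _ hk).trans_eq (norm_adj _)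
  -- `T(a_J)` has a nonzero row `g I` only if `g I ∈ J`, in which case the bound for `a_J` applies.
  have hterm : ∀ J ∈ Finset.univ.erase I,
      ‖((fockRep K (a J)).1 s).col (g I) (g I)‖ ≤ |C J| * (‖Y‖ * ‖a I‖) := by
    intro J hJ
    by_cases hIJ : g I ∈ principalRightIdeal (g J)
    · have hlt : I < J := by
        refine lt_of_le_of_ne ?_ (Finset.ne_of_mem_erase hJ).symm
        change (I : Set P) ⊆ J
        rw [← hg I, ← hg J]
        rintro _ ⟨r, rfl⟩
        obtain ⟨x, hx⟩ := hIJ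
        exact ⟨x * r, by rw [hx, mul_assoc]⟩
      calc ‖((fockRep K (a J)).1 s).col (g I) (g I)‖ ≤ ‖fockRep K (a J)‖ * ‖s‖ :=
            (Fock.norm_apply_le _ _ _).trans ((fockRep K (a J)).norm_apply_le s)
        _ ≤ (C J * ‖Y‖) * ‖a I‖ := mul_le_mul ((norm_fockOp_le _ _).trans (hC J hlt a ha)) hs1
            (norm_nonneg _) ((norm_nonneg _).trans (hC J hlt a ha))
        _ ≤ |C J| * (‖Y‖ * ‖a I‖) := by
            rw [mul_assoc]
            exact mul_le_mul_of_nonneg_right (le_abs_self _) (by positivity)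
    · have h0 : ((fockRep K (a J)).1 s).col (g I) (g I) = 0 :=
        fockFun_of_notMem _ _ _ (by
          rintro ⟨r, -, hr⟩
          exact hIJ ⟨r, hr.symm⟩)
      rw [h0, norm_zero]
      positivity
  -- Row `g I` of `T(a_I)` is left multiplication by `a_I`; the vector `s = a_I*` detects its norm.
  have hrow : ((fockRep K (a I)).1 s).col (g I) (g I) = comp (a I) (adj (a I)) := by
    have h := isRowMul_fockOp (K := K) Set.univ (a I) (Set.mem_univ 1) (mul_one _) (mul_one _)
    have h1 := h s (g I)
    rw [hs, Fock.single_apply] at h1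
    refine h1.trans ?_
    change comp (tensor 1 _ _ (a I)) _ = _
    rw [tensor_one]
  have hsum : (fockRep K (a I)).1 s
      = Y.1 s - ∑ J ∈ Finset.univ.erase I, (fockRep K (a J)).1 s := by
    have h1 : Y = fockRep K (a I) + ∑ J ∈ Finset.univ.erase I, fockRep K (a J) :=
      (Finset.add_sum_erase _ _ (Finset.mem_univ I)).symm
    have h2 : (∑ J ∈ Finset.univ.erase I, fockRep K (a J)).1 s
        = ∑ J ∈ Finset.univ.erase I, (fockRep K (a J)).1 s := by
      let e : FockOp K →+ Fock K :=
        { toFun := fun X => X.1 s, map_zero' := rfl, map_add' := fun _ _ => rfl }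
      exact map_sum e _ _
    rw [h1, FockOp.add_apply, h2, add_sub_cancel_right]
  have hcol : comp (a I) (adj (a I)) = (Y.1 s).col (g I) (g I)
      - ∑ J ∈ Finset.univ.erase I, ((fockRep K (a J)).1 s).col (g I) (g I) := by
    rw [← hrow, hsum]
    let e : Fock K →+ L (g I) (g I) :=
      { toFun := fun x => x.col (g I) (g I), map_zero' := rfl, map_add' := fun _ _ => rfl }
    exact (map_sub e _ _).trans (congrArg _ (map_sum e _ _))
  have h1 : ‖a I‖ ^ 2 ≤ ‖Y‖ * ‖a I‖ + (∑ J, |C J|) * (‖Y‖ * ‖a I‖) := by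
    have h2 := norm_adj_comp_self (adj (a I))
    rw [adj_adj, norm_adj] at h2
    rw [← h2, hcol]
    refine (norm_sub_le _ _).trans (add_le_add ?_ ?_)
    · exact (Fock.norm_apply_le _ _ _).trans ((Y.norm_apply_le s).trans
        (mul_le_mul_of_nonneg_left hs1 (norm_nonneg _)))
    · refine (norm_sum_le_of_le _ hterm).trans ?_
      rw [← Finset.sum_mul]
      refine mul_le_mul_of_nonneg_right ?_ (by positivity)
      exact Finset.sum_le_sum_of_subset_of_nonneg (Finset.erase_subset _ _)
        fun _ _ _ => abs_nonneg _
  rcases (norm_nonneg (a I)).eq_or_lt with h0 | h0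
  · rw [← h0]
    have : 0 ≤ ∑ J, |C J| := Finset.sum_nonneg fun _ _ => abs_nonneg _
    positivity
  · refine le_of_mul_le_mul_right ?_ h0
    nlinarith

/-- Restriction to the Fock module of the ideal is isometric on the *-algebra of a finite family of
principal right ideals. -/
lemma norm_fst_le_of_mem_idealAlgebra (hK : K.WellAligned) (hP : IsRightLCM P)
    {F : Set (Set P)} (hfin : F.Finite) (hprin : ∀ I ∈ F, ∃ p, principalRightIdeal p = I)
    (hF : ∀ I ∈ F, ∀ J ∈ F, (I ∩ J).Nonempty → I ∩ J ∈ F) :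
    ∀ z ∈ hK.idealAlgebra hP F hF, ‖z.1‖ ≤ ‖z.2‖ := by
  have := hfin.fintype
  choose g hg using fun I : F => hprin I I.2
  choose C hC using exists_norm_coeff_le (K := K) hg
  refine norm_fst_le_of_le_mul _ (∑ I, C I) fun z hz => ?_
  obtain ⟨a, ha, rfl⟩ := exists_eq_sum_of_mem_span hK hg hz
  rw [Prod.fst_sum, Prod.snd_sum, Finset.sum_mul]
  exact norm_sum_le_of_le _ fun I _ => (norm_fockOp_le _ _).trans (hC I a ha)

/-- The *-algebra of all linear combinations of pairs `(S(a), T(a))` with `a ∈ K p p`. -/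
noncomputable def HomIdeal.WellAligned.diagonalAlgebra (hK : K.WellAligned) (hP : IsRightLCM P) :
    NonUnitalStarSubalgebra ℂ (FockOp (⊤ : HomIdeal L) × FockOp K) :=
  hK.idealAlgebra hP Set.univ fun _ _ _ _ _ => Set.mem_univ _

lemma norm_fst_le_of_mem_diagonalAlgebra (hK : K.WellAligned) (hP : IsRightLCM P)
    {z : FockOp (⊤ : HomIdeal L) × FockOp K} (hz : z ∈ hK.diagonalAlgebra hP) :
    ‖z.1‖ ≤ ‖z.2‖ := by
  obtain ⟨T, hT, hzT⟩ := Submodule.mem_span_finite_of_mem_span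
    (show z ∈ Submodule.span ℂ (idealPairs K Set.univ) from hz)
  have hT' : ∀ y ∈ T, ∃ p, ∃ a ∈ K.hom p p, y = fockPair K a := fun y hy => by
    obtain ⟨p, a, ha, -, h⟩ := hT hy
    exact ⟨p, a, ha, h⟩
  choose! p hp using hT'
  obtain ⟨F, hfin, hGF, hprin, hF⟩ := exists_finite_closed_inter hP
    (T.finite_toSet.image fun y => principalRightIdeal (p y)) (by
      rintro _ ⟨y, -, rfl⟩
      exact ⟨p y, rfl⟩)
  refine norm_fst_le_of_mem_idealAlgebra hK hP hfin hprin hF z (Submodule.span_mono ?_ hzT)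
  intro y hy
  obtain ⟨a, ha, h⟩ := hp y hy
  exact ⟨p y, a, ha, hGF ⟨y, hy, rfl⟩, h⟩

/-- If `P` is cancellative, then `T_Δ(a)` is either `T(a)` with `a ∈ K p p`, or zero. -/
lemma diagPair_mem_diagonalAlgebra [IsRightCancelMul P] (hK : K.WellAligned) (hP : IsRightLCM P)
    {p q : P} {a : L p q} (ha : a ∈ K.hom p q) : diagPair K a ∈ hK.diagonalAlgebra hP := by
  by_cases h : p = q
  · subst h
    have e : diagPair K a = fockPair K a := Prod.ext (fockDiag_self a) (fockDiag_self a)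
    rw [e]
    exact Submodule.subset_span ⟨p, a, ha, Set.mem_univ _, rfl⟩
  · have e : diagPair K a = 0 := Prod.ext (fockDiag_of_ne h a) (fockDiag_of_ne h a)
    rw [e]
    exact zero_mem _

/-- A common *-algebra containing all pairs `(S_Δ(a), T_Δ(a))`, on which restriction to the Fock
module of the ideal is isometric. -/
lemma exists_isometric_diagonal_algebra (hK : K.WellAligned) (hP : IsRightLCM P)
    (h : IsRightCancelMul P ∨ K.IsEssentialIn K.generated) :
    ∃ D : NonUnitalStarSubalgebra ℂ (FockOp (⊤ : HomIdeal L) × FockOp K),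
      (∀ z ∈ D, ‖z.1‖ ≤ ‖z.2‖) ∧
      ∀ (p q : P) (a : L p q), a ∈ K.hom p q → diagPair K a ∈ D := by
  rcases h with h | h
  · exact ⟨hK.diagonalAlgebra hP, fun z hz => norm_fst_le_of_mem_diagonalAlgebra hK hP hz,
      fun p q a ha => diagPair_mem_diagonalAlgebra hK hP ha⟩
  · exact ⟨hK.diagonalPairs hP, fun z hz => norm_fst_le_of_mem_diagonalPairs hK hP h hz,
      fun p q a ha => diagPair_mem_diagonalPairs hK hP ha⟩

end Cancellative

/-! ### The embedding and the transcendental core -/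

section Embedding

variable {P : Type u} [Monoid P] [IsLeftCancelMul P] {L : P → P → Type v}
    [∀ p q, NormedAddCommGroup (L p q)] [∀ p q, NormedSpace ℂ (L p q)]
    [∀ p q, CompleteSpace (L p q)] [CStarPrecategory L] [RightTensoring L]

/-- The closed linear span of the pairs `(S_Δ(a), T_Δ(a))` with `a` in the ideal, which will be the
graph of the isomorphism of transcendental cores. -/
noncomputable def corePairs (K : HomIdeal L) :
    Submodule ℂ (FockOp (⊤ : HomIdeal L) × FockOp K) :=
  (Submodule.span ℂ
    {z | ∃ (p q : P) (a : L p q), a ∈ K.hom p q ∧ z = diagPair K a}).topologicalClosure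

variable {K : HomIdeal L}

lemma diagPair_mem {p q : P} {a : L p q} (ha : a ∈ K.hom p q) : diagPair K a ∈ corePairs K :=
  Submodule.le_topologicalClosure _ (Submodule.subset_span ⟨p, q, a, ha, rfl⟩)

lemma isClosed_corePairs : IsClosed (corePairs K : Set (FockOp (⊤ : HomIdeal L) × FockOp K)) :=
  Submodule.isClosed_topologicalClosure _

/-- Closed subspaces containing all pairs `(S_Δ(a), T_Δ(a))` contain their closed span. -/
lemma corePairs_le {V : Submodule ℂ (FockOp (⊤ : HomIdeal L) × FockOp K)}
    (hV : IsClosed (V : Set (FockOp (⊤ : HomIdeal L) × FockOp K)))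
    (h : ∀ (p q : P) (a : L p q), a ∈ K.hom p q → diagPair K a ∈ V) : corePairs K ≤ V :=
  Submodule.topologicalClosure_minimal _ (Submodule.span_le.2 fun _ ⟨p, q, a, ha, hz⟩ =>
    hz ▸ h p q a ha) hV

lemma fst_mem_of_mem_corePairs {z : FockOp (⊤ : HomIdeal L) × FockOp K} (hz : z ∈ corePairs K) :
    z.1 ∈ transCore (⊤ : HomIdeal L) :=
  corePairs_le (V := (transCore (⊤ : HomIdeal L)).comap (LinearMap.fst ℂ _ _))
    ((Submodule.isClosed_topologicalClosure _).preimage continuous_fst)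
    (fun _ _ _ _ => fockDiag_mem ⊤ trivial) hz

lemma snd_mem_of_mem_corePairs {z : FockOp (⊤ : HomIdeal L) × FockOp K} (hz : z ∈ corePairs K) :
    z.2 ∈ transCore K :=
  corePairs_le (V := (transCore K).comap (LinearMap.snd ℂ _ _))
    ((Submodule.isClosed_topologicalClosure _).preimage continuous_snd)
    (fun _ _ _ ha => fockDiag_mem K ha) hz

lemma expectation_eq_of_mem_transCore {z : FockOp K} (hz : z ∈ transCore K) :
    expectation z = z := by
  have : T2Space (FockOp K) := @instT2SpaceOfR1SpaceOfT0Space _ _ _ inferInstance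
  have hcl : IsClosed (LinearMap.eqLocus (expectationCLM K).toLinearMap LinearMap.id :
      Set (FockOp K)) := isClosed_eq (expectationCLM K).continuous continuous_id
  refine Submodule.topologicalClosure_minimal _ (Submodule.span_le.2 ?_) hcl hz
  rintro _ ⟨p, q, a, -, rfl⟩
  exact expectation_fockDiag a

lemma norm_snd_le_of_mem_corePairs {z : FockOp (⊤ : HomIdeal L) × FockOp K}
    (hz : z ∈ corePairs K) : ‖z.2‖ ≤ ‖z.1‖ :=
  norm_snd_le_of_mem_closure (FockOp.norm_snd_le_of_mem_span (by
    rintro _ ⟨p, q, a, -, rfl⟩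
    exact extends_fockOp _ a)) z hz

lemma corePairs_le_closure {D : NonUnitalStarSubalgebra ℂ (FockOp (⊤ : HomIdeal L) × FockOp K)}
    (hD : ∀ (p q : P) (a : L p q), a ∈ K.hom p q → diagPair K a ∈ D)
    {z : FockOp (⊤ : HomIdeal L) × FockOp K} (hz : z ∈ corePairs K) :
    z ∈ D.topologicalClosure :=
  corePairs_le (V := D.topologicalClosure.toNonUnitalSubalgebra.toSubmodule)
    D.isClosed_topologicalClosure (fun p q a ha => D.le_topologicalClosure (hD p q a ha)) hz

lemma pairExpectation_fockPair {p q : P} (a : L p q) :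
    pairExpectation K (fockPair K a) = diagPair K a := by
  rw [pairExpectation_apply]
  exact Prod.ext (expectation_fockRep a) (expectation_fockRep a)

/-- The conditional expectations map the closed *-algebra of pairs into the closed span of the pairs
`(S_Δ(a), T_Δ(a))`. -/
lemma expectation_mem_corePairs (hK : K.WellAligned) (hP : IsRightLCM P)
    {z : FockOp (⊤ : HomIdeal L) × FockOp K} (hz : z ∈ (hK.pairAlgebra hP).topologicalClosure) :
    (expectation z.1, expectation z.2) ∈ corePairs K := by
  rw [← pairExpectation_apply]
  refine map_mem_closure (pairExpectation K).continuous hz fun y hy => ?_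
  change y ∈ Submodule.span ℂ _ at hy
  induction hy using Submodule.span_induction with
  | mem x hx =>
    obtain ⟨p, q, a, ha, rfl⟩ := hx
    rw [pairExpectation_fockPair]
    exact Submodule.subset_span ⟨p, q, a, ha, rfl⟩
  | zero => rw [map_zero]; exact Submodule.zero_mem _
  | add x y _ _ hx hy => rw [map_add]; exact Submodule.add_mem _ hx hy
  | smul c x _ hx => rw [map_smul]; exact Submodule.smul_mem _ c hx

/-- Restriction to the Fock module of the ideal is isometric on the closed *-algebra generated by
the pairs `(S(a), T(a))`: it is isometric on the image of the faithful conditional expectation. -/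
lemma norm_fst_le_of_mem_closure_pairAlgebra (hK : K.WellAligned) (hP : IsRightLCM P)
    (hcore : ∀ z ∈ corePairs K, ‖z.1‖ ≤ ‖z.2‖) :
    ∀ z ∈ (hK.pairAlgebra hP).topologicalClosure, ‖z.1‖ ≤ ‖z.2‖ := by
  refine norm_fst_le_of_snd_injective _ (NonUnitalStarSubalgebra.isClosed_topologicalClosure _)
    fun z hz h0 => eq_zero_of_expectation_star_mul_self ?_
  have h1 := hcore _ (expectation_mem_corePairs hK hP (mul_mem (star_mem hz) hz))
  have h2 : expectation (star z * z).2 = 0 := by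
    rw [Prod.snd_mul, h0, mul_zero]
    exact (expectationCLM K).map_zero
  rw [h2, norm_zero] at h1
  exact norm_le_zero_iff.1 h1

lemma norm_snd_le_of_mem_closure_pairAlgebra (hK : K.WellAligned) (hP : IsRightLCM P)
    {z : FockOp (⊤ : HomIdeal L) × FockOp K} (hz : z ∈ (hK.pairAlgebra hP).topologicalClosure) :
    ‖z.2‖ ≤ ‖z.1‖ :=
  norm_snd_le_of_mem_closure (FockOp.norm_snd_le_of_mem_span (by
    rintro _ ⟨p, q, a, -, rfl⟩
    exact extends_fockOp _ a)) z hz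

lemma fst_mem_reducedNT (hK : K.WellAligned) (hP : IsRightLCM P)
    {z : FockOp (⊤ : HomIdeal L) × FockOp K} (hz : z ∈ (hK.pairAlgebra hP).topologicalClosure) :
    z.1 ∈ reducedNT (⊤ : HomIdeal L) := by
  have hcl : IsClosed ((reducedNT (⊤ : HomIdeal L)).toNonUnitalSubalgebra.toSubmodule.comap
      (LinearMap.fst ℂ (FockOp (⊤ : HomIdeal L)) (FockOp K)) :
        Set (FockOp (⊤ : HomIdeal L) × FockOp K)) :=
    (NonUnitalStarSubalgebra.isClosed_topologicalClosure _).preimage continuous_fst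
  refine Submodule.topologicalClosure_minimal _ (Submodule.span_le.2 ?_) hcl hz
  rintro _ ⟨p, q, a, -, rfl⟩
  exact fockRep_mem ⊤ trivial

/-- The second components of the closed *-algebra of pairs exhaust the reduced Nica–Toeplitz
algebra of the ideal. -/
lemma exists_mem_closure_pairAlgebra (hK : K.WellAligned) (hP : IsRightLCM P)
    (h : ∀ z ∈ (hK.pairAlgebra hP).topologicalClosure, ‖z.1‖ ≤ ‖z.2‖) {y : FockOp K}
    (hy : y ∈ reducedNT K) : ∃ x, (x, y) ∈ (hK.pairAlgebra hP).topologicalClosure := by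
  set H := (hK.pairAlgebra hP).topologicalClosure
  have hcl : IsClosed (H.map (NonUnitalStarAlgHom.snd ℂ (FockOp (⊤ : HomIdeal L)) (FockOp K)) :
      Set (FockOp K)) := by
    rw [NonUnitalStarSubalgebra.coe_map]
    exact isClosed_image_snd H.toNonUnitalSubalgebra.toSubmodule
      (NonUnitalStarSubalgebra.isClosed_topologicalClosure _) h
  have hle : reducedNT K ≤ H.map (NonUnitalStarAlgHom.snd ℂ _ _) := by
    refine NonUnitalStarSubalgebra.topologicalClosure_minimal _
      (NonUnitalStarAlgebra.adjoin_le ?_) hcl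
    rintro _ ⟨p, q, a, ha, rfl⟩
    exact ⟨fockPair K a,
      NonUnitalStarSubalgebra.le_topologicalClosure _ (hK.fockPair_mem hP ha), rfl⟩
  obtain ⟨z, hz, rfl⟩ := hle hy
  exact ⟨z.1, hz⟩

lemma exists_mem_corePairs (h : ∀ z ∈ corePairs K, ‖z.1‖ ≤ ‖z.2‖) {y : FockOp K}
    (hy : y ∈ transCore K) : ∃ x, (x, y) ∈ corePairs K := by
  have hcl : IsClosed ((corePairs K).map
      (LinearMap.snd ℂ (FockOp (⊤ : HomIdeal L)) (FockOp K)) : Set (FockOp K)) := by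
    rw [Submodule.map_coe]
    exact isClosed_image_snd _ isClosed_corePairs h
  have hle : transCore K ≤ (corePairs K).map (LinearMap.snd ℂ _ _) := by
    refine Submodule.topologicalClosure_minimal _ (Submodule.span_le.2 ?_) hcl
    rintro _ ⟨p, q, a, ha, rfl⟩
    exact ⟨diagPair K a, diagPair_mem ha, rfl⟩
  obtain ⟨z, hz, rfl⟩ := hle hy
  exact ⟨z.1, hz⟩

/-- The graphs of the embedding and of the map of cores agree where both are defined. For
`(X, z)` in the first and `(Z, z)` in the second, `E(X) = Z` and `E(X* X) = Z* Z`, since both sides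
have the same restriction; hence `E((X - Z)* (X - Z)) = 0`. -/
lemma eq_of_mem_pairAlgebra_of_mem_corePairs (hK : K.WellAligned) (hP : IsRightLCM P)
    {D : NonUnitalStarSubalgebra ℂ (FockOp (⊤ : HomIdeal L) × FockOp K)}
    (hD : ∀ z ∈ D, ‖z.1‖ ≤ ‖z.2‖)
    (hD' : ∀ (p q : P) (a : L p q), a ∈ K.hom p q → diagPair K a ∈ D)
    {X Z : FockOp (⊤ : HomIdeal L)} {z : FockOp K}
    (hX : (X, z) ∈ (hK.pairAlgebra hP).topologicalClosure) (hZ : (Z, z) ∈ corePairs K) :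
    X = Z := by
  have hiso : ∀ z ∈ D.topologicalClosure, ‖z.1‖ ≤ ‖z.2‖ := norm_fst_le_of_mem_closure hD
  have uniq : ∀ {A B : FockOp (⊤ : HomIdeal L)} {y : FockOp K}, (A, y) ∈ D.topologicalClosure →
      (B, y) ∈ D.topologicalClosure → A = B := fun hA hB =>
    graph_unique (V := D.topologicalClosure.toNonUnitalSubalgebra.toSubmodule) hiso hA hB
  have hmem := corePairs_le_closure hD' hZ
  have hEZ : expectation Z = Z := expectation_eq_of_mem_transCore (fst_mem_of_mem_corePairs hZ)
  have hEz : expectation z = z := expectation_eq_of_mem_transCore (snd_mem_of_mem_corePairs hZ)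
  have h1 : expectation X = Z := by
    have h := corePairs_le_closure hD' (expectation_mem_corePairs hK hP hX)
    simp only [hEz] at h
    exact uniq h hmem
  have h2 : expectation (star X * X) = star Z * Z := by
    have h := corePairs_le_closure hD'
      (expectation_mem_corePairs hK hP (mul_mem (star_mem hX) hX))
    -- `z` is diagonal, so `E(z* z) = z* z` is also the second component of `(Z, z)* (Z, z)`.
    have e : expectation (star z * z) = star z * z := by
      rw [expectation_mul_of_eq hEz, ← star_expectation, hEz]
    have h' : (expectation (star X * X), expectation (star z * z)) ∈ D.topologicalClosure := h
    rw [e] at h'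
    exact uniq h' (mul_mem (star_mem hmem) hmem)
  have h3 : expectation (star (X - Z) * (X - Z)) = 0 := by
    have hEZ' : expectation (star Z) = star Z := by rw [← star_expectation, hEZ]
    have e : star (X - Z) * (X - Z) = star X * X - star X * Z - (star Z * X - star Z * Z) := by
      rw [star_sub, sub_mul, mul_sub, mul_sub]
    rw [e, ← expectationCLM_apply, map_sub, map_sub, map_sub]
    simp only [expectationCLM_apply]
    rw [h2, expectation_mul_of_eq hEZ, expectation_mul_of_eq_left hEZ',
      expectation_mul_of_eq hEZ, ← star_expectation, h1, hEZ', sub_self]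
  exact sub_eq_zero.1 (eq_zero_of_expectation_star_mul_self h3)

/-- If `P` is cancellative, then the transcendental core is contained in the reduced Nica–Toeplitz
algebra. -/
lemma transCore_le_reducedNT [IsRightCancelMul P] {z : FockOp K} (hz : z ∈ transCore K) :
    z ∈ reducedNT K := by
  have hcl : IsClosed ((reducedNT K).toNonUnitalSubalgebra.toSubmodule : Set (FockOp K)) :=
    NonUnitalStarSubalgebra.isClosed_topologicalClosure _
  refine Submodule.topologicalClosure_minimal _ (Submodule.span_le.2 ?_) hcl hz
  rintro _ ⟨p, q, a, ha, rfl⟩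
  by_cases h : p = q
  · subst h
    rw [fockDiag_self]
    exact fockRep_mem K ha
  · rw [fockDiag_of_ne h]
    exact zero_mem _

end Embedding

end NicaToeplitz

theorem mainTheorem11 {P : Type u} [Monoid P] [IsLeftCancelMul P] (hP : IsRightLCM P)
    {L : P → P → Type v}
    [∀ p q, NormedAddCommGroup (L p q)] [∀ p q, NormedSpace ℂ (L p q)]
    [∀ p q, CompleteSpace (L p q)] [CStarPrecategory L] [RightTensoring L]
    (K : HomIdeal L) (hK : K.WellAligned)
    (h : IsRightCancelMul P ∨ K.IsEssentialIn K.generated) :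
    -- the embedding `ι` with `ι (T a) = S a`
    ∃ ι : reducedNT K →⋆ₙₐ[ℂ] reducedNT (⊤ : HomIdeal L),
      Function.Injective ι ∧ Isometry ι ∧
      (∀ (p q : P) (a : L p q) (ha : a ∈ K.hom p q),
        ι ⟨fockRep K a, fockRep_mem K ha⟩ = ⟨fockRep ⊤ a, fockRep_mem ⊤ trivial⟩) ∧
      -- the map `κ` induced by `ι` on transcendental cores
      ∃ κ : transCore K →ₗᵢ[ℂ] transCore (⊤ : HomIdeal L),
        (∀ (p q : P) (a : L p q) (ha : a ∈ K.hom p q),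
          κ ⟨fockDiag K a, fockDiag_mem K ha⟩ = ⟨fockDiag ⊤ a, fockDiag_mem ⊤ trivial⟩) ∧
        (∀ (z : FockOp K) (hz : z ∈ transCore K) (hz' : z ∈ reducedNT K),
          (κ ⟨z, hz⟩ : FockOp (⊤ : HomIdeal L)) = ι ⟨z, hz'⟩) ∧
        (IsRightCancelMul P → ∀ z ∈ transCore K, z ∈ reducedNT K) ∧
        -- `E^S ∘ ι = κ ∘ E^T`
        (∀ x : reducedNT K, ∃ hx : expectation (x : FockOp K) ∈ transCore K,
          expectation (ι x : FockOp (⊤ : HomIdeal L)) = κ ⟨expectation (x : FockOp K), hx⟩) := by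
  obtain ⟨D, hD, hD'⟩ := exists_isometric_diagonal_algebra hK hP h
  have hcore : ∀ z ∈ corePairs K, ‖z.1‖ ≤ ‖z.2‖ := fun z hz =>
    norm_fst_le_of_mem_closure hD z (corePairs_le_closure hD' hz)
  have hpair := norm_fst_le_of_mem_closure_pairAlgebra hK hP hcore
  obtain ⟨ι, hι, hιgraph⟩ := exists_starAlgHom_of_graph _ hpair
    (fun z hz => norm_snd_le_of_mem_closure_pairAlgebra hK hP hz)
    (reducedNT (⊤ : HomIdeal L)) (reducedNT K) (fun z hz => fst_mem_reducedNT hK hP hz)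
    (fun y hy => exists_mem_closure_pairAlgebra hK hP hpair hy)
  obtain ⟨κ, hκgraph⟩ := exists_linearIsometry_of_graph _ hcore
    (fun z hz => norm_snd_le_of_mem_corePairs hz) (transCore (⊤ : HomIdeal L)) (transCore K)
    (fun z hz => fst_mem_of_mem_corePairs hz) (fun y hy => exists_mem_corePairs hcore hy)
  refine ⟨ι, hι.injective, hι, fun p q a ha => Subtype.ext ?_, κ, fun p q a ha => Subtype.ext ?_,
    fun z hz hz' => ?_, fun hc z hz => transCore_le_reducedNT hz, fun x => ?_⟩
  · exact graph_unique
      (V := (hK.pairAlgebra hP).topologicalClosure.toNonUnitalSubalgebra.toSubmodule) hpair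
      (hιgraph ⟨fockRep K a, fockRep_mem K ha⟩)
      (NonUnitalStarSubalgebra.le_topologicalClosure _ (hK.fockPair_mem hP ha))
  · exact graph_unique hcore (hκgraph ⟨fockDiag K a, fockDiag_mem K ha⟩) (diagPair_mem ha)
  · exact (eq_of_mem_pairAlgebra_of_mem_corePairs hK hP hD hD' (hιgraph ⟨z, hz'⟩)
      (hκgraph ⟨z, hz⟩)).symm
  · have hx := expectation_mem_corePairs hK hP (hιgraph x)
    exact ⟨snd_mem_of_mem_corePairs hx, graph_unique hcore hx (hκgraph ⟨_, _⟩)⟩
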